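/- Let $(X,d)$ be a strongly discrete metric space of bounded geometry: the set of values of $d$ is a discrete subset of $\mathbb{R}$, and for every $r>0$ the closed balls $B(x,r)$, $x\in X$, are finite with uniformly bounded cardinality. For $r>0$ put $E_r=\{(x,y)\in X\times X: d(x,y)\le r\}$. Let $\beta X$ be the Stone–Čech compactification of the discrete set $X$ (the space of ultrafilters on $X$), $\partial_\beta X=\beta X\setminus X$, and for $D\subseteq X$ let $\overline{D}$ be the closure of $D$ in $\beta X$. The coarse groupoid is $G(X)=\bigcup_{r>0}\overline{E_r}\subseteq\beta(X\times X)$ with the subspace topology, unit space $\beta X$, range and source maps extending $(x,y)\mapsto x$ and $(x,y)\mapsto y$, and operations induced from the pair groupoid $\beta X\times\beta X$ through the injection $(\mathrm r,\mathrm s)$. Let $U\subseteq\beta X$ be open and invariant ($\mathrm r^{-1}(U)=\mathrm s^{-1}(U)$), write $U^c=\partial_\beta X\setminus U$, and let $\mathbf L(U)=\{Y\subseteq X:\overline{Y}\subseteq U\}$ be the associated ideal in $X$. $X$ has partial Property A towards $U^c$ if the reduction $\mathcal G=G(X)_{U^c}$ is amenable: for all $\varepsilon>0$ and all compact $K\subseteq\mathcal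 G$ there is $f\in C_c(\mathcal G)$ with values in $[0,1]$ such that for all $\gamma\in K$, $\sum_{\alpha\in\mathcal G_{\mathrm r(\gamma)}}f(\alpha)=1$ and $\sum_{\alpha\in\mathcal G_{\mathrm r(\gamma)}}|f(\alpha)-f(\alpha\gamma)|<\varepsilon$, where $\mathcal G_x=\mathrm s^{-1}(x)$. Then $X$ has partial Property A towards $U^c$ if and only if any one of the following equivalent conditions holds: (i) For all $\varepsilon,R>0$ there are $S>0$, a set $D\subseteq X$ with $\overline{D}\supseteq U^c$ and a function $f:X\times X\to[0,1]$ such that $f$ vanishes outside $E_S$; $\sum_{z\in X}f(z,x)=1$ for all $x\in D$; and $\sum_{z\in X}|f(z,x)-f(z,y)|\le\varepsilon$ for all $x,y\in D$ with $d(x,y)\le R$. (ii) For all $\varepsilon,R>0$ there are $S>0$, a set $D\subseteq X$ with $\overline{D}\supseteq U^c$ and a map $x\mapsto\xi_x$ from $D$ to the non-negative unit vectors of $\ell^1(X)$ such that $\mathrm{supp}(\xi_x)\subseteq B(x,S)$ for all $x\in D$, and $\|\xi_x-\xi_y\|_1\le\varepsilon$ for all $x,y\in D$ with $d(x,y)\le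 R$. (iii) For all $\varepsilon,R>0$ there are $S>0$, a set $Y\in\mathbf L(U)$ and a map $x\mapsto\xi_x$ from $Y^c=X\setminus Y$ to the non-negative unit vectors of $\ell^2(Y^c)$ such that $\mathrm{supp}(\xi_x)\subseteq B(x,S)$ for all $x\in Y^c$, and $\|\xi_x-\xi_y\|_2\le\varepsilon$ for all $x,y\in Y^c$ with $d(x,y)\le R$. (iv) For all $\varepsilon,R>0$ there are $S>0$, a set $Y\in\mathbf L(U)$ and a kernel $k:Y^c\times Y^c\to\mathbb R$ of positive type (that is, $\sum_{i,j=1}^n\lambda_i\lambda_jk(x_i,x_j)\ge0$ for all $n\in\mathbb N$, $x_i\in Y^c$, $\lambda_i\in\mathbb R$) such that $k(x,y)=k(y,x)$ and $k(x,x)=1$ for all $x,y\in Y^c$; $k(x,y)=0$ whenever $d(x,y)\ge S$; and $|1-k(x,y)|\le\varepsilon$ whenever $d(x,y)\le R$. -/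

import Mathlib

open Set Topology

/-! ### Groupoids given by their arrows, reductions, amenability -/

/-- A groupoid with unit space `G₀` and set of arrows `G`; `mul a b` is defined when
`src a = rng b`. -/
structure ArrowGroupoid (G₀ G : Type*) where
  src : G → G₀
  rng : G → G₀
  unit : G₀ → G
  inv : G → G
  mul : (a b : G) → src a = rng b → G
  src_unit : ∀ x, src (unit x) = x
  rng_unit : ∀ x, rng (unit x) = x
  src_inv : ∀ a, src (inv a) = rng a
  rng_inv : ∀ a, rng (inv a) = src a
  src_mul : ∀ a b h, src (mul a b h) = src b
  rng_mul : ∀ a b h, rng (mul a b h) = rng a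
  mul_assoc : ∀ (a b c : G) (hab : src a = rng b) (hbc : src b = rng c),
    mul (mul a b hab) c ((src_mul a b hab).trans hbc) =
      mul a (mul b c hbc) (hab.trans (rng_mul b c hbc).symm)
  unit_mul : ∀ a, mul (unit (rng a)) a (src_unit (rng a)) = a
  mul_unit : ∀ a, mul a (unit (src a)) (rng_unit (src a)).symm = a
  inv_mul : ∀ a, mul (inv a) a (src_inv a) = unit (src a)
  mul_inv : ∀ a, mul a (inv a) (rng_inv a).symm = unit (rng a)

namespace ArrowGroupoid

variable {G₀ G : Type*}

/-- A set of units is invariant if `r⁻¹(Y) = s⁻¹(Y)`. -/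
def IsInvariant (𝒢 : ArrowGroupoid G₀ G) (Y : Set G₀) : Prop :=
  𝒢.rng ⁻¹' Y = 𝒢.src ⁻¹' Y

/-- The reduction of a groupoid to a set `Y` of units: all arrows with range and source in `Y`.
Its set of arrows carries the subspace topology when `G` has a topology. -/
def reduction (𝒢 : ArrowGroupoid G₀ G) (Y : Set G₀) :
    ArrowGroupoid Y {γ : G // 𝒢.rng γ ∈ Y ∧ 𝒢.src γ ∈ Y} where
  src γ := ⟨𝒢.src γ.1, γ.2.2⟩
  rng γ := ⟨𝒢.rng γ.1, γ.2.1⟩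
  unit x := ⟨𝒢.unit x.1, by rw [𝒢.rng_unit, 𝒢.src_unit]; exact ⟨x.2, x.2⟩⟩
  inv γ := ⟨𝒢.inv γ.1, by rw [𝒢.rng_inv, 𝒢.src_inv]; exact ⟨γ.2.2, γ.2.1⟩⟩
  mul a b h := ⟨𝒢.mul a.1 b.1 (congrArg Subtype.val h), by
    rw [𝒢.rng_mul, 𝒢.src_mul]; exact ⟨a.2.1, b.2.2⟩⟩
  src_unit x := Subtype.ext (𝒢.src_unit x.1)
  rng_unit x := Subtype.ext (𝒢.rng_unit x.1)
  src_inv a := Subtype.ext (𝒢.src_inv a.1)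
  rng_inv a := Subtype.ext (𝒢.rng_inv a.1)
  src_mul a b h := Subtype.ext (𝒢.src_mul a.1 b.1 (congrArg Subtype.val h))
  rng_mul a b h := Subtype.ext (𝒢.rng_mul a.1 b.1 (congrArg Subtype.val h))
  mul_assoc a b c hab hbc := Subtype.ext
    (𝒢.mul_assoc a.1 b.1 c.1 (congrArg Subtype.val hab) (congrArg Subtype.val hbc))
  unit_mul a := Subtype.ext (𝒢.unit_mul a.1)
  mul_unit a := Subtype.ext (𝒢.mul_unit a.1)
  inv_mul a := Subtype.ext (𝒢.inv_mul a.1)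
  mul_inv a := Subtype.ext (𝒢.mul_inv a.1)

/-- Topological amenability (for locally compact Hausdorff étale groupoids): for all `ε > 0` and all compact sets `K` of arrows there is
`f ∈ C_c(G)` with values in `[0,1]` such that for every `γ ∈ K`, the sum of `f(α)` over
`α ∈ G_{r(γ)}` is `1` and the sum of `|f(α) - f(αγ)|` over `α ∈ G_{r(γ)}` is less than `ε`. -/
def IsAmenable [TopologicalSpace G] (𝒢 : ArrowGroupoid G₀ G) : Prop :=
  ∀ ε : ℝ, 0 < ε → ∀ K : Set G, IsCompact K →
    ∃ f : G → ℝ, Continuous f ∧ HasCompactSupport f ∧ (∀ γ, f γ ∈ Icc (0 : ℝ) 1) ∧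
      ∀ γ ∈ K,
        HasSum (fun α : {α : G // 𝒢.src α = 𝒢.rng γ} => f α.1) 1 ∧
        Summable (fun α : {α : G // 𝒢.src α = 𝒢.rng γ} => |f α.1 - f (𝒢.mul α.1 γ α.2)|) ∧
        ∑' α : {α : G // 𝒢.src α = 𝒢.rng γ}, |f α.1 - f (𝒢.mul α.1 γ α.2)| < ε

end ArrowGroupoid

/-! ### Metric spaces -/

/-- Bounded geometry: for each `r > 0` the closed balls of radius `r` are finite, with uniformly
bounded cardinality. -/
def BoundedGeometry (X : Type*) [MetricSpace X] : Prop :=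
  ∀ r : ℝ, 0 < r → ∃ N : ℕ, ∀ x : X, (Metric.closedBall x r).encard ≤ N

/-- Strong discreteness: the set of distances is a discrete subset of `ℝ`. -/
def StronglyDiscrete (X : Type*) [MetricSpace X] : Prop :=
  DiscreteTopology (range fun p : X × X => dist p.1 p.2)

/-- The entourage `E_r`. -/
def entourage (X : Type*) [MetricSpace X] (r : ℝ) : Set (X × X) :=
  {p | dist p.1 p.2 ≤ r}

/-! ### The Stone-Čech compactification of a discrete set

`βA` is the space `Ultrafilter A`; a point `a` is identified with the principal ultrafilter
`pure a`. -/

/-- The closure in `βA` of a subset `D` of `A`. -/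
def betaClosure {A : Type*} (D : Set A) : Set (Ultrafilter A) :=
  closure ((pure : A → Ultrafilter A) '' D)

/-- The Stone-Čech boundary `βX ∖ X`. -/
def betaBoundary (X : Type*) : Set (Ultrafilter X) :=
  (range (pure : X → Ultrafilter X))ᶜ

theorem mem_betaClosure_iff {A : Type*} {D : Set A} {ω : Ultrafilter A} :
    ω ∈ betaClosure D ↔ D ∈ ω := by
  unfold betaClosure
  rw [ultrafilterBasis_is_basis.mem_closure_iff]
  constructor
  · intro h
    by_contra hD
    obtain ⟨u, hu, ⟨a, ha, rfl⟩⟩ := h {u | Dᶜ ∈ u} ⟨Dᶜ, rfl⟩ (Ultrafilter.compl_mem_iff_notMem.2 hD)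
    exact (Ultrafilter.mem_pure.1 hu) ha
  · rintro hD _ ⟨s, rfl⟩ hs
    obtain ⟨a, ha, haD⟩ := ω.nonempty_of_mem (Filter.inter_mem hs hD)
    exact ⟨pure a, Ultrafilter.mem_pure.2 ha, a, haD, rfl⟩

/-! ### The coarse groupoid -/

/-- The space of arrows of the coarse groupoid: the union over `r > 0` of the closures of the
entourages `E_r` in `β(X × X)`, with the subspace topology. -/
def CoarseArrow (X : Type*) [MetricSpace X] : Type _ :=
  {p : Ultrafilter (X × X) // p ∈ ⋃ r ∈ Ioi (0 : ℝ), betaClosure (entourage X r)}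

instance (X : Type*) [MetricSpace X] : TopologicalSpace (CoarseArrow X) :=
  inferInstanceAs (TopologicalSpace
    {p : Ultrafilter (X × X) // p ∈ ⋃ r ∈ Ioi (0 : ℝ), betaClosure (entourage X r)})

namespace CoarseArrow

variable {X : Type*} [MetricSpace X]

/-- The extension to `β(X × X)` of the source map `(x, y) ↦ y`. -/
def src (γ : CoarseArrow X) : Ultrafilter X := γ.1.map Prod.snd

/-- The extension to `β(X × X)` of the range map `(x, y) ↦ x`. -/
def rng (γ : CoarseArrow X) : Ultrafilter X := γ.1.map Prod.fst

theorem mem_iff {p : Ultrafilter (X × X)} :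
    p ∈ ⋃ r ∈ Ioi (0 : ℝ), betaClosure (entourage X r) ↔ ∃ r : ℝ, 0 < r ∧ entourage X r ∈ p := by
  simp [mem_betaClosure_iff]

/-- In a space of bounded geometry, the points can be coloured with finitely many colours such
that distinct points at distance at most `r` have distinct colours. -/
theorem exists_coloring (hX : BoundedGeometry X) {r : ℝ} (hr : 0 < r) :
    ∃ (N : ℕ) (c : X → Fin N), ∀ x y, dist x y ≤ r → c x = c y → x = y := by
  obtain ⟨N, hN⟩ := hX r hr
  let lt : X → X → Prop := WellOrderingRel
  have wf : WellFounded lt := (inferInstance : IsWellFounded X WellOrderingRel).wf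
  let F : (x : X) → ((y : X) → lt y x → ℕ) → ℕ := fun x ih =>
    sInf {n | ∀ y (h : lt y x), dist x y ≤ r → ih y h ≠ n}
  let c : X → ℕ := wf.fix F
  have hc : ∀ x, c x = sInf {n | ∀ y, lt y x → dist x y ≤ r → c y ≠ n} := fun x =>
    wf.fix_eq F x
  have key : ∀ x, ∃ n ∈ {n | ∀ y, lt y x → dist x y ≤ r → c y ≠ n}, n < N + 1 := by
    intro x
    by_contra hcon
    push Not at hcon
    have hsub : ((Finset.range (N + 1) : Finset ℕ) : Set ℕ) ⊆ c '' Metric.closedBall x r := by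
      intro n hn
      have hn' : n < N + 1 := by simpa using hn
      by_contra hnot
      refine absurd (hcon n ?_) (not_le.2 hn')
      intro y _ hy hcy
      exact hnot ⟨y, by rwa [Metric.mem_closedBall, dist_comm], hcy⟩
    have h1 := (encard_le_encard hsub).trans ((encard_image_le _ _).trans (hN x))
    rw [encard_coe_eq_coe_finsetCard, Finset.card_range] at h1
    have : N + 1 ≤ N := by exact_mod_cast h1
    omega
  have hlt : ∀ x, c x < N + 1 := fun x => by
    obtain ⟨n, hn, hnN⟩ := key x
    rw [hc x]
    exact (Nat.sInf_le hn).trans_lt hnN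
  have hne : ∀ x y, lt y x → dist x y ≤ r → c y ≠ c x := by
    intro x y hyx hd
    obtain ⟨n, hn, -⟩ := key x
    have := Nat.sInf_mem ⟨n, hn⟩
    rw [← hc x] at this
    exact this y hyx hd
  refine ⟨N + 1, fun x => ⟨c x, hlt x⟩, fun x y hd hxy => ?_⟩
  have hxy' : c x = c y := congrArg Fin.val hxy
  rcases trichotomous_of WellOrderingRel x y with h | h | h
  · exact absurd hxy' (hne y x h (by rwa [dist_comm]))
  · exact h
  · exact absurd hxy'.symm (hne x y h hd)

/-- The map `(r, s) : G(X) → βX × βX` is injective. -/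
theorem ext_of_rng_src (hX : BoundedGeometry X) {a b : CoarseArrow X}
    (hr : a.rng = b.rng) (hs : a.src = b.src) : a = b := by
  obtain ⟨p, hp⟩ := a
  obtain ⟨q, hq⟩ := b
  obtain ⟨R, hR, hpR⟩ := mem_iff.1 hp
  obtain ⟨S, hS, hqS⟩ := mem_iff.1 hq
  obtain ⟨N, c, hc⟩ := exists_coloring hX (r := R + S + (R + S)) (by linarith)
  change p.map Prod.fst = q.map Prod.fst at hr
  change p.map Prod.snd = q.map Prod.snd at hs
  obtain ⟨i, hi⟩ : ∃ i, c ⁻¹' {i} ∈ p.map Prod.fst := by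
    have : (⋃ i ∈ (univ : Set (Fin N)), c ⁻¹' {i}) ∈ p.map Prod.fst := by
      have hu : (⋃ i ∈ (univ : Set (Fin N)), c ⁻¹' {i}) = univ := by ext x; simp
      rw [hu]
      exact Filter.univ_mem
    obtain ⟨i, -, hi⟩ := (Ultrafilter.finite_biUnion_mem_iff finite_univ).1 this
    exact ⟨i, hi⟩
  set T : Set (X × X) := {z | dist z.1 z.2 ≤ R + S ∧ c z.1 = i} with hT
  have hTp : T ∈ p := by
    filter_upwards [hpR, (Ultrafilter.mem_map.1 hi)] with z h1 h2
    exact ⟨le_trans h1 (by linarith), h2⟩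
  have hTq : T ∈ q := by
    rw [hr] at hi
    filter_upwards [hqS, (Ultrafilter.mem_map.1 hi)] with z h1 h2
    exact ⟨le_trans h1 (by linarith), h2⟩
  have hinj : InjOn Prod.snd T := by
    rintro ⟨x, y⟩ ⟨h1, h2⟩ ⟨x', y'⟩ ⟨h1', h2'⟩ h
    simp only at h1 h2 h1' h2' h
    subst h
    have : x = x' := hc x x' ((dist_triangle_right x x' y).trans (by linarith)) (h2.trans h2'.symm)
    rw [this]
  have hle : (q : Filter (X × X)) ≤ p := by
    intro A hA
    have h1 : Prod.snd '' (A ∩ T) ∈ p.map Prod.snd :=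
      Ultrafilter.mem_map.2 (Filter.mem_of_superset (Filter.inter_mem hA hTp)
        (subset_preimage_image _ _))
    rw [hs] at h1
    filter_upwards [Ultrafilter.mem_map.1 h1, hTq] with z hz hzT
    obtain ⟨w, ⟨hwA, hwT⟩, hw⟩ := hz
    rwa [← hinj hwT hzT hw]
  exact Subtype.ext (Ultrafilter.coe_le_coe.1 hle).symm

/-- Composable arrows have a product. -/
theorem exists_mul (a b : CoarseArrow X) (h : a.src = b.rng) :
    ∃ e : CoarseArrow X, e.rng = a.rng ∧ e.src = b.src := by
  obtain ⟨p, hp⟩ := a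
  obtain ⟨q, hq⟩ := b
  obtain ⟨R, hR, hpR⟩ := mem_iff.1 hp
  obtain ⟨S, hS, hqS⟩ := mem_iff.1 hq
  change p.map Prod.snd = q.map Prod.fst at h
  let f : X × X × X → X × X := fun t => (t.1, t.2.1)
  let g : X × X × X → X × X := fun t => (t.2.1, t.2.2)
  have hne : (Filter.comap f p ⊓ Filter.comap g q).NeBot := by
    rw [Filter.inf_neBot_iff]
    rintro s ⟨A, hA, hAs⟩ t ⟨B, hB, hBt⟩
    have h1 : Prod.snd '' A ∈ p.map Prod.snd :=
      Ultrafilter.mem_map.2 (Filter.mem_of_superset hA (subset_preimage_image _ _))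
    have h2 : Prod.fst '' B ∈ p.map Prod.snd := by
      rw [h]
      exact Ultrafilter.mem_map.2 (Filter.mem_of_superset hB (subset_preimage_image _ _))
    obtain ⟨y, ⟨⟨x, y₁⟩, hxA, hy₁⟩, ⟨⟨y₂, z⟩, hzB, hy₂⟩⟩ :=
      (p.map Prod.snd).nonempty_of_mem (Filter.inter_mem h1 h2)
    simp only at hy₁ hy₂
    subst hy₁ hy₂
    exact ⟨(x, y₂, z), hAs hxA, hBt hzB⟩
  let u : Ultrafilter (X × X × X) := Ultrafilter.of (Filter.comap f p ⊓ Filter.comap g q)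
  have hu : (u : Filter _) ≤ Filter.comap f p ⊓ Filter.comap g q := Ultrafilter.of_le _
  have huf : u.map f = p :=
    Ultrafilter.coe_le_coe.1 (Filter.map_le_iff_le_comap.2 (hu.trans inf_le_left))
  have hug : u.map g = q :=
    Ultrafilter.coe_le_coe.1 (Filter.map_le_iff_le_comap.2 (hu.trans inf_le_right))
  refine ⟨⟨u.map fun t => (t.1, t.2.2), mem_iff.2 ⟨R + S, by linarith, ?_⟩⟩, ?_, ?_⟩
  · rw [← huf] at hpR
    rw [← hug] at hqS
    apply Ultrafilter.mem_map.2
    filter_upwards [Ultrafilter.mem_map.1 hpR, Ultrafilter.mem_map.1 hqS] with t h1 h2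
    exact (dist_triangle t.1 t.2.1 t.2.2).trans (add_le_add h1 h2)
  · change (u.map fun t => (t.1, t.2.2)).map Prod.fst = p.map Prod.fst
    rw [← huf, Ultrafilter.map_map, Ultrafilter.map_map]
    rfl
  · change (u.map fun t => (t.1, t.2.2)).map Prod.snd = q.map Prod.snd
    rw [← hug, Ultrafilter.map_map, Ultrafilter.map_map]
    rfl

/-- The unit at `ω`: the image of `ω` under the diagonal map. -/
def unit (ω : Ultrafilter X) : CoarseArrow X :=
  ⟨ω.map fun x => (x, x), mem_iff.2 ⟨1, one_pos, by
    have hu : (fun x : X => (x, x)) ⁻¹' entourage X 1 = univ := by ext x; simp [entourage]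
    apply Ultrafilter.mem_map.2
    rw [hu]
    exact Filter.univ_mem⟩⟩

/-- The inverse: the image under the flip. -/
def inv (γ : CoarseArrow X) : CoarseArrow X :=
  ⟨γ.1.map Prod.swap, by
    obtain ⟨r, hr, h⟩ := mem_iff.1 γ.2
    refine mem_iff.2 ⟨r, hr, Ultrafilter.mem_map.2 ?_⟩
    filter_upwards [h] with z hz
    simpa [entourage, dist_comm] using hz⟩

theorem src_unit (ω : Ultrafilter X) : (unit ω).src = ω := by
  change (ω.map fun x => (x, x)).map Prod.snd = ω
  rw [Ultrafilter.map_map]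
  exact ω.map_id

theorem rng_unit (ω : Ultrafilter X) : (unit ω).rng = ω := by
  change (ω.map fun x => (x, x)).map Prod.fst = ω
  rw [Ultrafilter.map_map]
  exact ω.map_id

theorem src_inv (γ : CoarseArrow X) : γ.inv.src = γ.rng := by
  change (γ.1.map Prod.swap).map Prod.snd = γ.1.map Prod.fst
  rw [Ultrafilter.map_map]
  rfl

theorem rng_inv (γ : CoarseArrow X) : γ.inv.rng = γ.src := by
  change (γ.1.map Prod.swap).map Prod.fst = γ.1.map Prod.snd
  rw [Ultrafilter.map_map]
  rfl

/-- The product of two composable arrows: the arrow (unique, in bounded geometry) with the range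
of the first and the source of the second. -/
noncomputable def mul (a b : CoarseArrow X) (h : a.src = b.rng) : CoarseArrow X :=
  (exists_mul a b h).choose

theorem rng_mul (a b : CoarseArrow X) (h : a.src = b.rng) : (mul a b h).rng = a.rng :=
  (exists_mul a b h).choose_spec.1

theorem src_mul (a b : CoarseArrow X) (h : a.src = b.rng) : (mul a b h).src = b.src :=
  (exists_mul a b h).choose_spec.2

end CoarseArrow

/-- The coarse groupoid `G(X)` of a metric space of bounded geometry, with unit space `βX` and
with the operations transported from the pair groupoid `βX × βX` along `(r, s)`. -/
noncomputable def coarseGroupoid (X : Type*) [MetricSpace X] (hX : BoundedGeometry X) :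
    ArrowGroupoid (Ultrafilter X) (CoarseArrow X) where
  src := CoarseArrow.src
  rng := CoarseArrow.rng
  unit := CoarseArrow.unit
  inv := CoarseArrow.inv
  mul := CoarseArrow.mul
  src_unit := CoarseArrow.src_unit
  rng_unit := CoarseArrow.rng_unit
  src_inv := CoarseArrow.src_inv
  rng_inv := CoarseArrow.rng_inv
  src_mul := CoarseArrow.src_mul
  rng_mul := CoarseArrow.rng_mul
  mul_assoc a b c hab hbc := CoarseArrow.ext_of_rng_src hX
    (by simp only [CoarseArrow.rng_mul]) (by simp only [CoarseArrow.src_mul])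
  unit_mul a := CoarseArrow.ext_of_rng_src hX
    (by rw [CoarseArrow.rng_mul, CoarseArrow.rng_unit]) (by rw [CoarseArrow.src_mul])
  mul_unit a := CoarseArrow.ext_of_rng_src hX
    (by rw [CoarseArrow.rng_mul]) (by rw [CoarseArrow.src_mul, CoarseArrow.src_unit])
  inv_mul a := CoarseArrow.ext_of_rng_src hX
    (by rw [CoarseArrow.rng_mul, CoarseArrow.rng_inv, CoarseArrow.rng_unit])
    (by rw [CoarseArrow.src_mul, CoarseArrow.src_unit])
  mul_inv a := CoarseArrow.ext_of_rng_src hX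
    (by rw [CoarseArrow.rng_mul, CoarseArrow.rng_unit])
    (by rw [CoarseArrow.src_mul, CoarseArrow.src_inv, CoarseArrow.src_unit])

/-! ### Partial Property A, ideals in spaces, kernels -/

/-- `X` has partial Property A towards a set `Z` of points of `βX` (used for `Z = ∂_β X ∖ U` with
`U` open and invariant) if the reduction of the coarse groupoid to `Z` is amenable. -/
def HasPartialPropertyA (X : Type*) [MetricSpace X] (hX : BoundedGeometry X)
    (Z : Set (Ultrafilter X)) : Prop :=
  ((coarseGroupoid X hX).reduction Z).IsAmenable

/-- The family `L(U)` of the subsets of `X` whose closure in `βX` lies in `U`; when `U` is open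
and invariant it is the ideal in `X` associated with `U`. -/
def idealOf {X : Type*} (U : Set (Ultrafilter X)) : Set (Set X) :=
  {Y | betaClosure Y ⊆ U}

/-- Real kernels of positive type. -/
def IsPositiveType {A : Type*} (k : A → A → ℝ) : Prop :=
  ∀ (n : ℕ) (x : Fin n → A) (c : Fin n → ℝ), 0 ≤ ∑ i, ∑ j, c i * c j * k (x i) (x j)

/-! An arrow of `G(X)` is an ultrafilter on `X × X` containing some `E_S`, and bounded geometry
makes it the graph of a map over its source: after colouring `X` with finitely many colours, a point
`z` within `S` of `x` is recovered from `x` and the colour of `z` (`exists_section`). So if `F` on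
`X × X` is supported in `E_S` and converges along every arrow, a groupoid fibre carries only
finitely many non-zero limit values, and their sum is the limit of the sums of `F` over `X`
(`hasSum_fibre`). This carries the two amenability estimates back and forth between the reduction
and `X`.

From (i), the function extends continuously to `β(X × X)` and restricts to the reduction.
Conversely, a function in `C_c` comes from some `F` by Tietze. Its estimates hold near every
ultrafilter finer than the product of two copies of the filter of sets whose closure contains `U^c`,
hence on a single square `D × D`, and normalising `F` there gives (i). Condition (ii) is (i) read
column by column.

The other conditions form a cycle. The vectors `√f(·, x)` have a Gram matrix that is a kernel as in
(iv). A kernel of positive type and finite propagation defines a positive bounded operator `T` on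
`ℓ²`. A polynomial in `T` close to a square root of a multiple of `T` still has finite propagation,
so its columns, made non-negative and normalised, give (iii). Squaring coordinates returns to (i).

Passing from `D` to a set of `L(U)` costs something only for `U = ∅`: otherwise `X ⊆ U` and `Dᶜ`
already lies in `L(U)`, while for `U = ∅` the set `Dᶜ` is finite and the function is extended over
it with a bump function. -/

/-! ### Arrows as graphs, and fibre sums as limits -/

theorem BoundedGeometry.finite_closedBall {X : Type*} [MetricSpace X] (hX : BoundedGeometry X)
    (x : X) (r : ℝ) : (Metric.closedBall x r).Finite := by
  obtain ⟨N, hN⟩ := hX (max r 1) (by positivity)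
  refine Set.Finite.subset ?_ (Metric.closedBall_subset_closedBall (le_max_left r 1))
  exact Set.finite_of_encard_le_coe (hN x)

/-- The entourage `E_S` is covered by the graphs of finitely many maps. -/
theorem exists_section {X : Type*} [MetricSpace X] (hX : BoundedGeometry X) {S : ℝ} (hS : 0 < S) :
    ∃ (N : ℕ) (c : X → Fin N) (t : Fin N → X → X),
      ∀ z x, dist z x ≤ S → t (c z) x = z := by
  classical
  -- Two points within `S` of the same `x` are within `2S` of each other, so at this scale the
  -- colour separates them.
  obtain ⟨N, c, hc⟩ := CoarseArrow.exists_coloring hX (r := S + S) (by linarith)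
  refine ⟨N, c, fun i x => if h : ∃ z, dist z x ≤ S ∧ c z = i then h.choose else x, ?_⟩
  intro z x hzx
  have h : ∃ w, dist w x ≤ S ∧ c w = c z := ⟨z, hzx, rfl⟩
  simp only [dif_pos h]
  obtain ⟨h1, h2⟩ := h.choose_spec
  exact hc _ _ ((dist_triangle_right _ _ x).trans (add_le_add h1 hzx)) h2

theorem Ultrafilter.exists_color_mem {A : Type*} {N : ℕ} (p : Ultrafilter A) (c : A → Fin N) :
    ∃ i, {a | c a = i} ∈ p := by
  have : (⋃ i ∈ (univ : Set (Fin N)), {a | c a = i}) ∈ p := by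
    have hu : (⋃ i ∈ (univ : Set (Fin N)), {a | c a = i}) = univ := by ext x; simp
    rw [hu]
    exact Filter.univ_mem
  obtain ⟨i, -, hi⟩ := (Ultrafilter.finite_biUnion_mem_iff finite_univ).1 this
  exact ⟨i, hi⟩

theorem Ultrafilter.map_congr' {A B : Type*} {p : Ultrafilter A} {f g : A → B}
    (h : ∀ᶠ a in (p : Filter A), f a = g a) : p.map f = p.map g :=
  Ultrafilter.coe_injective (Filter.map_congr h)

/-- An arrow of the coarse groupoid is the graph of a map over its source. -/
theorem Ultrafilter.eq_map_section {X : Type*} [MetricSpace X] (hX : BoundedGeometry X) {S : ℝ}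
    (hS : 0 < S) {p : Ultrafilter (X × X)} (hp : entourage X S ∈ p) :
    ∃ t : X → X, p = (p.map Prod.snd).map fun x => (t x, x) := by
  obtain ⟨N, c, t, ht⟩ := exists_section hX hS
  obtain ⟨i, hi⟩ := p.exists_color_mem (fun a => c a.1)
  refine ⟨t i, ?_⟩
  rw [Ultrafilter.map_map]
  conv_lhs => rw [← Ultrafilter.map_id p]
  apply Ultrafilter.map_congr'
  filter_upwards [hp, hi] with a h1 h2
  have := ht a.1 a.2 h1
  rw [show c a.1 = i from h2] at this
  exact Prod.ext this.symm rfl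

open Filter in
/-- The sum over a fibre of the coarse groupoid as a limit of sums over `X`. -/
theorem hasSum_fibre {X I : Type*} [MetricSpace X] (hX : BoundedGeometry X)
    (γ : Ultrafilter (X × X)) (e : I → Ultrafilter (X × X)) (he : Function.Injective e)
    (hrange : ∀ p : Ultrafilter (X × X), (∃ i, e i = p) ↔
      (∃ r : ℝ, 0 < r ∧ entourage X r ∈ p) ∧ p.map Prod.snd = γ.map Prod.fst)
    (Φ : I → ℝ) (H : X → X × X → ℝ) {S : ℝ} (hS : 0 < S)
    (hH : ∀ᶠ a in (γ : Filter (X × X)), ∀ z, H z a ≠ 0 → dist z a.1 ≤ S)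
    (hΦ : ∀ i (t : X → X), e i = γ.map (fun a => (t a.1, a.1)) →
      Tendsto (fun a => H (t a.1) a) γ (𝓝 (Φ i))) :
    ∃ s, HasSum Φ s ∧ Tendsto (fun a => ∑' z, H z a) γ (𝓝 s) := by
  classical
  obtain ⟨N, c, t, ht⟩ := exists_section hX hS
  -- `Dm i` is where the branch `t i` really produces a point of colour `i` in the ball. `J`
  -- collects the branches for which this happens along `γ`; they are the only arrows of the fibre
  -- that can contribute.
  let Dm : Fin N → Set (X × X) := fun i => {a | dist (t i a.1) a.1 ≤ S ∧ c (t i a.1) = i}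
  let J : Finset (Fin N) := Finset.univ.filter fun i => Dm i ∈ γ
  have hmap : ∀ i, (γ.map (fun a => (t i a.1, a.1))).map Prod.snd = γ.map Prod.fst := fun i => by
    rw [Ultrafilter.map_map]; rfl
  have hσ : ∀ i : Fin N, ∃ k : I, i ∈ J → e k = γ.map (fun a => (t i a.1, a.1)) := by
    intro i
    by_cases hi : i ∈ J
    · have hi' : Dm i ∈ γ := (Finset.mem_filter.1 hi).2
      obtain ⟨k, hk⟩ := (hrange (γ.map (fun a => (t i a.1, a.1)))).2 ⟨⟨S, hS, by
        apply Ultrafilter.mem_map.2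
        filter_upwards [hi'] with a h1
        exact h1.1⟩, hmap i⟩
      exact ⟨k, fun _ => hk⟩
    -- For branches outside `J` the value is irrelevant; the unit at the range of `γ` shows that the
    -- fibre is non-empty.
    · obtain ⟨k, -⟩ := (hrange ((γ.map Prod.fst).map fun x => (x, x))).2 ⟨⟨1, one_pos, by
        apply Ultrafilter.mem_map.2
        filter_upwards with a
        simp [entourage]⟩, by
          rw [Ultrafilter.map_map]; exact Ultrafilter.map_id _⟩
      exact ⟨k, fun h => absurd h hi⟩
  choose σ hσ using hσ
  have hσinj : Set.InjOn σ J := by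
    intro i hi j hj hij
    have h1 := hσ i hi
    rw [hij, hσ j hj] at h1
    have hi' : Dm i ∈ γ := (Finset.mem_filter.1 hi).2
    have hj' : Dm j ∈ γ := (Finset.mem_filter.1 hj).2
    have h2 : {q : X × X | c q.1 = i} ∈ γ.map (fun a => (t j a.1, a.1)) := by
      rw [h1]
      apply Ultrafilter.mem_map.2
      filter_upwards [hi'] with a ha using ha.2
    obtain ⟨a, ha1, ha2⟩ := γ.nonempty_of_mem (Filter.inter_mem (Ultrafilter.mem_map.1 h2) hj')
    exact (show c (t j a.1) = i from ha1).symm.trans ha2.2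
  refine ⟨∑ i ∈ J, Φ (σ i), ?_, ?_⟩
  · rw [← Finset.sum_image hσinj]
    apply hasSum_sum_of_ne_finset_zero
    intro k hk
    obtain ⟨⟨r, hr, hrk⟩, hsnd⟩ := (hrange (e k)).1 ⟨k, rfl⟩
    by_cases hSk : entourage X S ∈ e k
    · exfalso
      obtain ⟨i, hi⟩ := (e k).exists_color_mem (fun a => c a.1)
      have hek : e k = γ.map (fun a => (t i a.1, a.1)) := by
        have : γ.map (fun a => (t i a.1, a.1)) = (e k).map fun a => (t i a.2, a.2) := by
          rw [show (fun a : X × X => (t i a.1, a.1)) = (fun x => (t i x, x)) ∘ Prod.fst from rfl,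
            ← Ultrafilter.map_map, ← hsnd, Ultrafilter.map_map]
          rfl
        rw [this]
        conv_lhs => rw [← Ultrafilter.map_id (e k)]
        apply Ultrafilter.map_congr'
        filter_upwards [hSk, hi] with a h1 h2
        have := ht a.1 a.2 h1
        rw [show c a.1 = i from h2] at this
        exact Prod.ext this.symm rfl
      have hiJ : i ∈ J := by
        refine Finset.mem_filter.2 ⟨Finset.mem_univ _, ?_⟩
        have h3 := Filter.inter_mem hSk hi
        rw [hek] at h3
        exact Ultrafilter.mem_map.1 h3
      exact hk (Finset.mem_image.2 ⟨i, hiJ, he ((hσ i hiJ).trans hek.symm)⟩)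
    -- An arrow not containing `E_S` is the graph of a map that moves points by more than `S` along
    -- `γ`, so `H` is eventually zero on it and `Φ` vanishes there.
    · obtain ⟨u, hu⟩ := Ultrafilter.eq_map_section hX hr hrk
      rw [hsnd, Ultrafilter.map_map] at hu
      refine tendsto_nhds_unique (hΦ k u hu) ?_
      refine tendsto_const_nhds.congr' ?_
      rw [hu, ← Ultrafilter.compl_mem_iff_notMem] at hSk
      filter_upwards [hH, Ultrafilter.mem_map.1 hSk] with a h1 h2
      by_contra h3
      exact h2 (h1 _ (Ne.symm h3))
  · have hev : ∀ᶠ a in (γ : Filter (X × X)), ∑ i ∈ J, H (t i a.1) a = ∑' z, H z a := by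
      -- There are finitely many branches, so one set of `γ` decides all of them at once; on it the
      -- sum over `X` is exactly the sum over `J`.
      have h1 : ∀ᶠ a in (γ : Filter (X × X)), ∀ i, a ∈ Dm i ↔ i ∈ J := by
        rw [Filter.eventually_all]
        intro i
        by_cases hi : Dm i ∈ γ
        · filter_upwards [hi] with a ha
          exact iff_of_true ha (Finset.mem_filter.2 ⟨Finset.mem_univ _, hi⟩)
        · filter_upwards [Ultrafilter.compl_mem_iff_notMem.2 hi] with a ha
          exact iff_of_false ha fun h => hi (Finset.mem_filter.1 h).2
      filter_upwards [h1, hH] with a ha hHa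
      have hinj : Set.InjOn (fun i => t i a.1) J := by
        intro i hi j hj hij
        have h2 := ((ha i).2 hi).2
        have h3 := ((ha j).2 hj).2
        rw [show t i a.1 = t j a.1 from hij] at h2
        exact h2.symm.trans h3
      rw [← Finset.sum_image (f := fun z => H z a) hinj]
      symm
      apply tsum_eq_sum
      intro z hz
      by_contra hne
      have hd := hHa z hne
      have htz := ht z a.1 hd
      refine hz (Finset.mem_image.2 ⟨c z, (ha (c z)).1 ⟨?_, ?_⟩, htz⟩)
      · rw [htz]; exact hd
      · rw [htz]
    refine Tendsto.congr' hev ?_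
    exact tendsto_finsetSum _ fun i hi => hΦ _ _ (hσ i hi)

/-! ### Arrows, products and compact sets in the reduction -/

section Reduction

variable {X : Type*} [MetricSpace X]

/-- The arrows of the reduction of the coarse groupoid to `Z`. -/
abbrev ReducedArrow (X : Type*) [MetricSpace X] (hX : BoundedGeometry X)
    (Z : Set (Ultrafilter X)) : Type _ :=
  {γ : CoarseArrow X // (coarseGroupoid X hX).rng γ ∈ Z ∧ (coarseGroupoid X hX).src γ ∈ Z}

/-- An arrow of the reduction as an ultrafilter on `X × X`. -/
def ReducedArrow.toUltrafilter {hX : BoundedGeometry X} {Z : Set (Ultrafilter X)}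
    (γ : ReducedArrow X hX Z) : Ultrafilter (X × X) := γ.1.1

theorem ReducedArrow.isEmbedding_toUltrafilter (hX : BoundedGeometry X) (Z : Set (Ultrafilter X)) :
    IsEmbedding (ReducedArrow.toUltrafilter : ReducedArrow X hX Z → Ultrafilter (X × X)) :=
  IsEmbedding.comp (g := fun γ : CoarseArrow X => γ.1) IsEmbedding.subtypeVal
    IsEmbedding.subtypeVal

theorem ReducedArrow.exists_entourage {hX : BoundedGeometry X} {Z : Set (Ultrafilter X)}
    (γ : ReducedArrow X hX Z) : ∃ r : ℝ, 0 < r ∧ entourage X r ∈ γ.toUltrafilter :=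
  CoarseArrow.mem_iff.1 γ.1.2

theorem ReducedArrow.map_fst_mem {hX : BoundedGeometry X} {Z : Set (Ultrafilter X)}
    (γ : ReducedArrow X hX Z) : γ.toUltrafilter.map Prod.fst ∈ Z := γ.2.1

theorem ReducedArrow.map_snd_mem {hX : BoundedGeometry X} {Z : Set (Ultrafilter X)}
    (γ : ReducedArrow X hX Z) : γ.toUltrafilter.map Prod.snd ∈ Z := γ.2.2

theorem ReducedArrow.exists_toUltrafilter_eq (hX : BoundedGeometry X) (Z : Set (Ultrafilter X))
    (p : Ultrafilter (X × X)) {r : ℝ} (hr : 0 < r) (hp : entourage X r ∈ p)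
    (h1 : p.map Prod.fst ∈ Z) (h2 : p.map Prod.snd ∈ Z) :
    ∃ γ : ReducedArrow X hX Z, γ.toUltrafilter = p :=
  ⟨⟨⟨p, CoarseArrow.mem_iff.2 ⟨r, hr, hp⟩⟩, h1, h2⟩, rfl⟩

open Filter in
/-- The limit form of fibre sums in the reduction to an invariant set. -/
theorem ReducedArrow.hasSum_fibre {hX : BoundedGeometry X} {Z : Set (Ultrafilter X)}
    (hZ : (coarseGroupoid X hX).IsInvariant Z) (γ : ReducedArrow X hX Z)
    (Φ : {α : ReducedArrow X hX Z //
      ((coarseGroupoid X hX).reduction Z).src α = ((coarseGroupoid X hX).reduction Z).rng γ} → ℝ)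
    (H : X → X × X → ℝ) {S : ℝ} (hS : 0 < S)
    (hH : ∀ᶠ a in (γ.toUltrafilter : Filter (X × X)), ∀ z, H z a ≠ 0 → dist z a.1 ≤ S)
    (hΦ : ∀ α (t : X → X), α.1.toUltrafilter = γ.toUltrafilter.map (fun a => (t a.1, a.1)) →
      Tendsto (fun a => H (t a.1) a) γ.toUltrafilter (𝓝 (Φ α))) :
    ∃ s, HasSum Φ s ∧ Tendsto (fun a => ∑' z, H z a) γ.toUltrafilter (𝓝 s) := by
  refine _root_.hasSum_fibre hX γ.toUltrafilter (fun α => α.1.toUltrafilter)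
    ((ReducedArrow.isEmbedding_toUltrafilter hX Z).injective.comp Subtype.val_injective)
    ?_ Φ H hS hH hΦ
  intro p
  constructor
  · rintro ⟨α, rfl⟩
    exact ⟨α.1.exists_entourage, congrArg Subtype.val α.2⟩
  · rintro ⟨⟨r, hr, hp⟩, h2⟩
    let q : CoarseArrow X := ⟨p, CoarseArrow.mem_iff.2 ⟨r, hr, hp⟩⟩
    have hs : (coarseGroupoid X hX).src q ∈ Z := by
      change p.map Prod.snd ∈ Z
      rw [h2]; exact γ.map_fst_mem
    have hr' : (coarseGroupoid X hX).rng q ∈ Z := by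
      have : q ∈ (coarseGroupoid X hX).src ⁻¹' Z := hs
      rwa [← hZ] at this
    exact ⟨⟨⟨q, hr', hs⟩, Subtype.ext h2⟩, rfl⟩

/-- The product is only a chosen arrow, but an arrow is determined by its range and source, so it
suffices to compare both with those of the explicit candidate. -/
theorem ReducedArrow.toUltrafilter_mul {hX : BoundedGeometry X} {Z : Set (Ultrafilter X)}
    (α γ : ReducedArrow X hX Z)
    (h : ((coarseGroupoid X hX).reduction Z).src α = ((coarseGroupoid X hX).reduction Z).rng γ)
    (t : X → X) (ht : α.toUltrafilter = γ.toUltrafilter.map (fun a => (t a.1, a.1))) :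
    ReducedArrow.toUltrafilter (((coarseGroupoid X hX).reduction Z).mul α γ h) =
      γ.toUltrafilter.map (fun a => (t a.1, a.2)) := by
  obtain ⟨r, hr, h1⟩ := α.exists_entourage
  obtain ⟨r', hr', h2⟩ := γ.exists_entourage
  rw [ht] at h1
  let q : CoarseArrow X := ⟨γ.toUltrafilter.map (fun a => (t a.1, a.2)),
    CoarseArrow.mem_iff.2 ⟨r + r', by linarith, Ultrafilter.mem_map.2 (by
      filter_upwards [Ultrafilter.mem_map.1 h1, h2] with a h3 h4
      exact (dist_triangle (t a.1) a.1 a.2).trans (add_le_add h3 h4))⟩⟩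
  have hq : CoarseArrow.mul α.1 γ.1 (congrArg Subtype.val h) = q := by
    apply CoarseArrow.ext_of_rng_src hX
    · refine (CoarseArrow.rng_mul _ _ _).trans ?_
      change α.toUltrafilter.map Prod.fst = (γ.toUltrafilter.map (fun a => (t a.1, a.2))).map Prod.fst
      rw [ht, Ultrafilter.map_map, Ultrafilter.map_map]
      rfl
    · refine (CoarseArrow.src_mul _ _ _).trans ?_
      change γ.toUltrafilter.map Prod.snd = (γ.toUltrafilter.map (fun a => (t a.1, a.2))).map Prod.snd
      rw [Ultrafilter.map_map]
      rfl
  exact congrArg Subtype.val hq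

open Filter in
theorem ReducedArrow.hasSum_apply {hX : BoundedGeometry X} {Z : Set (Ultrafilter X)}
    (hZ : (coarseGroupoid X hX).IsInvariant Z) {S : ℝ} (hS : 0 < S) (F : X × X → ℝ)
    (hF : Function.support F ⊆ entourage X S) (f : ReducedArrow X hX Z → ℝ)
    (hFf : ∀ α : ReducedArrow X hX Z, Tendsto F α.toUltrafilter (𝓝 (f α)))
    (γ : ReducedArrow X hX Z) :
    ∃ s, HasSum (fun α : {α : ReducedArrow X hX Z // ((coarseGroupoid X hX).reduction Z).src α =
        ((coarseGroupoid X hX).reduction Z).rng γ} => f α.1) s ∧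
      Tendsto (fun a : X × X => ∑' z, F (z, a.1)) γ.toUltrafilter (𝓝 s) := by
  refine ReducedArrow.hasSum_fibre hZ γ (fun α => f α.1) (fun z a => F (z, a.1)) hS
    (Eventually.of_forall fun a z h => hF h) ?_
  intro α t ht
  have := hFf α.1
  rw [ht, Ultrafilter.coe_map, tendsto_map'_iff] at this
  exact this

-- When `α` is the graph of `t` over the range of `γ`, both `f α` and `f (αγ)` are limits along `γ`,
-- of `F (t a.1, a.1)` and `F (t a.1, a.2)`. The propagation grows to `S + r`, since a point near
-- `a.2` is only that near to `a.1`.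
open Filter in
theorem ReducedArrow.hasSum_abs_sub {hX : BoundedGeometry X} {Z : Set (Ultrafilter X)}
    (hZ : (coarseGroupoid X hX).IsInvariant Z) {S : ℝ} (hS : 0 < S) (F : X × X → ℝ)
    (hF : Function.support F ⊆ entourage X S) (f : ReducedArrow X hX Z → ℝ)
    (hFf : ∀ α : ReducedArrow X hX Z, Tendsto F α.toUltrafilter (𝓝 (f α)))
    (γ : ReducedArrow X hX Z) :
    ∃ s, HasSum (fun α : {α : ReducedArrow X hX Z // ((coarseGroupoid X hX).reduction Z).src α =
        ((coarseGroupoid X hX).reduction Z).rng γ} =>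
          |f α.1 - f (((coarseGroupoid X hX).reduction Z).mul α.1 γ α.2)|) s ∧
      Tendsto (fun a : X × X => ∑' z, |F (z, a.1) - F (z, a.2)|) γ.toUltrafilter (𝓝 s) := by
  obtain ⟨r, hr, hγ⟩ := γ.exists_entourage
  refine ReducedArrow.hasSum_fibre hZ γ _ (fun z a => |F (z, a.1) - F (z, a.2)|)
    (S := S + r) (by linarith) ?_ ?_
  · filter_upwards [hγ] with a ha z hz
    by_cases h1 : F (z, a.1) = 0
    · have h2 : F (z, a.2) ≠ 0 := fun h2 => hz (by rw [h1, h2]; simp)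
      exact (dist_triangle_right z a.1 a.2).trans (add_le_add (hF h2) ha)
    · have : dist z a.1 ≤ S := hF h1
      linarith
  · intro α t ht
    have h1 := hFf α.1
    have h2 := hFf (((coarseGroupoid X hX).reduction Z).mul α.1 γ α.2)
    rw [ReducedArrow.toUltrafilter_mul α.1 γ α.2 t ht] at h2
    rw [ht, Ultrafilter.coe_map, tendsto_map'_iff] at h1
    rw [Ultrafilter.coe_map, tendsto_map'_iff] at h2
    exact (h1.sub h2).abs

theorem Ultrafilter.continuous_map {A B : Type*} (f : A → B) :
    Continuous (Ultrafilter.map f : Ultrafilter A → Ultrafilter B) := by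
  refine ultrafilterBasis_is_basis.continuous_iff.2 ?_
  rintro _ ⟨s, rfl⟩
  exact ultrafilter_isOpen_basic (f ⁻¹' s)

theorem isClosed_arrows {Z : Set (Ultrafilter X)} (hZ : IsClosed Z) (S : ℝ) :
    IsClosed {p : Ultrafilter (X × X) | entourage X S ∈ p ∧ p.map Prod.fst ∈ Z ∧
      p.map Prod.snd ∈ Z} :=
  (ultrafilter_isClosed_basic _).inter ((hZ.preimage (Ultrafilter.continuous_map _)).inter
    (hZ.preimage (Ultrafilter.continuous_map _)))

/-- The image in the compact space `β(X × X)` is closed, because `Z` is closed and basic sets of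
ultrafilters are clopen. -/
theorem ReducedArrow.isCompact_setOf_mem (hX : BoundedGeometry X) {Z : Set (Ultrafilter X)}
    (hZ : IsClosed Z) {S : ℝ} (hS : 0 < S) :
    IsCompact {γ : ReducedArrow X hX Z | entourage X S ∈ γ.toUltrafilter} := by
  rw [(ReducedArrow.isEmbedding_toUltrafilter hX Z).isInducing.isCompact_iff]
  convert (isClosed_arrows hZ S).isCompact
  ext p
  constructor
  · rintro ⟨γ, hγ, rfl⟩
    exact ⟨hγ, γ.map_fst_mem, γ.map_snd_mem⟩
  · rintro ⟨h1, h2, h3⟩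
    obtain ⟨γ, rfl⟩ := ReducedArrow.exists_toUltrafilter_eq hX Z p hS h1 h2 h3
    exact ⟨γ, h1, rfl⟩

/-- The arrows containing `E_{n+1}` form an increasing open cover, so compact sets have bounded
propagation. -/
theorem ReducedArrow.exists_entourage_of_isCompact {hX : BoundedGeometry X}
    {Z : Set (Ultrafilter X)} {K : Set (ReducedArrow X hX Z)} (hK : IsCompact K) :
    ∃ r : ℝ, 0 < r ∧ ∀ γ ∈ K, entourage X r ∈ γ.toUltrafilter := by
  obtain ⟨n, hn⟩ := hK.elim_directed_cover
    (fun n : ℕ => {γ : ReducedArrow X hX Z | entourage X (n + 1) ∈ γ.toUltrafilter})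
    (fun n => (ultrafilter_isOpen_basic _).preimage
      (ReducedArrow.isEmbedding_toUltrafilter hX Z).continuous)
    (fun γ _ => by
      obtain ⟨r, hr, h⟩ := γ.exists_entourage
      obtain ⟨n, hn⟩ := exists_nat_ge r
      refine Set.mem_iUnion.2 ⟨n, ?_⟩
      exact Filter.mem_of_superset h fun a (ha : dist _ _ ≤ r) =>
        show dist _ _ ≤ (n : ℝ) + 1 by linarith)
    (by
      refine Monotone.directed_le fun m n hmn γ h => ?_
      have : (m : ℝ) ≤ n := by exact_mod_cast hmn
      exact Filter.mem_of_superset h fun a (ha : dist _ _ ≤ (m : ℝ) + 1) =>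
        show dist _ _ ≤ (n : ℝ) + 1 by linarith)
  exact ⟨n + 1, by positivity, fun γ hγ => hn hγ⟩

end Reduction

/-! ### Amenability of the reduction as a condition on functions on `X × X` -/

section Function

variable {X : Type*} [MetricSpace X]

/-- The filter of the sets whose closures in `βX` contain `Z`. -/
def closureFilter {A : Type*} (Z : Set (Ultrafilter A)) : Filter A := ⨆ ω ∈ Z, (ω : Filter A)

theorem mem_closureFilter {A : Type*} {Z : Set (Ultrafilter A)} {D : Set A} :
    D ∈ closureFilter Z ↔ Z ⊆ betaClosure D := by
  simp only [closureFilter, Filter.mem_iSup]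
  exact ⟨fun h ω hω => mem_betaClosure_iff.2 (h ω hω), fun h ω hω => mem_betaClosure_iff.1 (h hω)⟩

/-- A point outside the closed set `Z` has a basic neighbourhood missing `Z`, and the complement of
the corresponding subset of `A` belongs to the filter. -/
theorem mem_of_le_closureFilter {A : Type*} {Z : Set (Ultrafilter A)} (hZ : IsClosed Z)
    {ω : Ultrafilter A}
    (h : (ω : Filter A) ≤ closureFilter Z) : ω ∈ Z := by
  by_contra hω
  obtain ⟨_, ⟨s, rfl⟩, hs, hsub⟩ :=
    ultrafilterBasis_is_basis.exists_subset_of_mem_open (a := ω) (u := Zᶜ) hω hZ.isOpen_compl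
  have : sᶜ ∈ closureFilter Z := by
    refine mem_closureFilter.2 fun u hu => mem_betaClosure_iff.2 ?_
    exact Ultrafilter.compl_mem_iff_notMem.2 fun hsu => hsub hsu hu
  exact Ultrafilter.compl_mem_iff_notMem.1 (h this) hs

theorem finite_support_of_subset_entourage (hX : BoundedGeometry X) {S : ℝ} {F : X × X → ℝ}
    (hF : Function.support F ⊆ entourage X S) (x : X) :
    (Function.support fun z => F (z, x)).Finite :=
  (hX.finite_closedBall x S).subset fun z hz => hF (a := (z, x)) hz

/-- The description of partial Property A by functions on `X × X`. -/
def FunctionCondition (Z : Set (Ultrafilter X)) : Prop :=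
  ∀ ε : ℝ, 0 < ε → ∀ R : ℝ, 0 < R →
    ∃ S : ℝ, 0 < S ∧ ∃ D : Set X, Z ⊆ betaClosure D ∧
      ∃ f : X × X → ℝ, (∀ p, f p ∈ Set.Icc (0 : ℝ) 1) ∧
        Function.support f ⊆ entourage X S ∧
        (∀ x ∈ D, HasSum (fun z => f (z, x)) 1) ∧
        (∀ x ∈ D, ∀ y ∈ D, dist x y ≤ R →
          Summable (fun z => |f (z, x) - f (z, y)|) ∧
          ∑' z, |f (z, x) - f (z, y)| ≤ ε)

open Filter in
theorem hasPartialPropertyA_of_functionCondition (hX : BoundedGeometry X)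
    {Z : Set (Ultrafilter X)} (hZc : IsClosed Z) (hZ : (coarseGroupoid X hX).IsInvariant Z)
    (h : FunctionCondition Z) : HasPartialPropertyA X hX Z := by
  intro ε hε K hK
  obtain ⟨R, hR, hKR⟩ := ReducedArrow.exists_entourage_of_isCompact hK
  -- Half of `ε`, because passing to the limit only keeps a weak inequality.
  obtain ⟨S, hS, D, hD, F, hF01, hFS, hF1, hFR⟩ := h (ε / 2) (by positivity) R hR
  let F' : X × X → Icc (0 : ℝ) 1 := fun p => ⟨F p, hF01 p⟩
  let f : ReducedArrow X hX Z → ℝ := fun α =>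
    Subtype.val (Ultrafilter.extend F' α.toUltrafilter)
  have hFf : ∀ α : ReducedArrow X hX Z, Tendsto F α.toUltrafilter (𝓝 (f α)) := by
    intro α
    have : Tendsto F' α.toUltrafilter (𝓝 (Ultrafilter.extend F' α.toUltrafilter)) :=
      ultrafilter_extend_eq_iff.1 rfl
    exact ((continuous_subtype_val (p := fun r : ℝ => r ∈ Icc (0 : ℝ) 1)).tendsto _).comp this
  have : T2Space (ReducedArrow X hX Z) :=
    (ReducedArrow.isEmbedding_toUltrafilter hX Z).t2Space
  refine ⟨f, ?_, ?_, fun α : ReducedArrow X hX Z => (Ultrafilter.extend F' α.toUltrafilter).2, ?_⟩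
  · exact continuous_subtype_val.comp ((continuous_ultrafilter_extend F').comp
      (ReducedArrow.isEmbedding_toUltrafilter hX Z).continuous)
  · refine HasCompactSupport.of_support_subset_isCompact
      (ReducedArrow.isCompact_setOf_mem hX hZc hS) fun (α : ReducedArrow X hX Z) hα => ?_
    by_contra hn
    refine hα (tendsto_nhds_unique (hFf α) (tendsto_const_nhds.congr' ?_))
    filter_upwards [Ultrafilter.compl_mem_iff_notMem.2 hn] with p hp
    by_contra h0
    exact hp (hFS (Ne.symm h0))
  · intro (γ : ReducedArrow X hX Z) hγ
    have hD1 : ∀ᶠ a in (γ.toUltrafilter : Filter (X × X)), a.1 ∈ D :=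
      Ultrafilter.mem_map.1 (mem_betaClosure_iff.1 (hD γ.map_fst_mem))
    have hD2 : ∀ᶠ a in (γ.toUltrafilter : Filter (X × X)), a.2 ∈ D :=
      Ultrafilter.mem_map.1 (mem_betaClosure_iff.1 (hD γ.map_snd_mem))
    obtain ⟨s, hs, hs'⟩ := ReducedArrow.hasSum_apply hZ hS F hFS f hFf γ
    obtain ⟨v, hv, hv'⟩ := ReducedArrow.hasSum_abs_sub hZ hS F hFS f hFf γ
    have hs1 : s = 1 := by
      refine tendsto_nhds_unique hs' (tendsto_const_nhds.congr' ?_)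
      filter_upwards [hD1] with a ha using (hF1 _ ha).tsum_eq.symm
    have hvε : v ≤ ε / 2 := by
      refine le_of_tendsto hv' ?_
      filter_upwards [hD1, hD2, hKR γ hγ] with a h1 h2 h3
      exact (hFR _ h1 _ h2 h3).2
    subst hs1
    refine ⟨hs, hv.summable, ?_⟩
    rw [hv.tsum_eq]
    linarith

-- The support lies in the compact set of arrows containing a fixed `E_S`. Tietze extends `f` from
-- there to `β(X × X)`, and restricting to principal ultrafilters and cutting off outside `E_S`
-- gives `F`.
open Filter in
theorem ReducedArrow.exists_function_tendsto {hX : BoundedGeometry X} {Z : Set (Ultrafilter X)}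
    (hZc : IsClosed Z) {f : ReducedArrow X hX Z → ℝ} (hf : Continuous f)
    (hfc : HasCompactSupport f) (hf01 : ∀ γ, f γ ∈ Icc (0 : ℝ) 1) :
    ∃ S : ℝ, 0 < S ∧ ∃ F : X × X → ℝ, (∀ p, F p ∈ Icc (0 : ℝ) 1) ∧
      Function.support F ⊆ entourage X S ∧
      ∀ α : ReducedArrow X hX Z, Tendsto F α.toUltrafilter (𝓝 (f α)) := by
  classical
  obtain ⟨S, hS, hfS⟩ := ReducedArrow.exists_entourage_of_isCompact hfc
  let C := {γ : ReducedArrow X hX Z | entourage X S ∈ γ.toUltrafilter}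
  have hemb := ReducedArrow.isEmbedding_toUltrafilter hX Z
  let e : C → Ultrafilter (X × X) := fun γ => γ.1.toUltrafilter
  have : CompactSpace C := isCompact_iff_compactSpace.1
    (ReducedArrow.isCompact_setOf_mem hX hZc hS)
  have he : IsClosedEmbedding e :=
    (hemb.continuous.comp continuous_subtype_val).isClosedEmbedding
      (hemb.injective.comp Subtype.val_injective)
  obtain ⟨g, hg01, hg⟩ := ContinuousMap.exists_extension_forall_mem_of_isClosedEmbedding
    (⟨fun γ : C => f γ, hf.comp continuous_subtype_val⟩ : C(C, ℝ)) (t := Icc 0 1)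
    (fun γ => hf01 γ) ⟨0, by simp⟩ he
  refine ⟨S, hS, fun p => if p ∈ entourage X S then g (pure p) else 0, ?_, ?_, ?_⟩
  · intro p
    dsimp only
    split_ifs
    · exact hg01 _
    · simp
  · intro p hp
    by_contra hn
    exact hp (if_neg hn)
  · intro α
    by_cases hα : entourage X S ∈ α.toUltrafilter
    · have h1 : Tendsto (fun p => g (pure p)) α.toUltrafilter (𝓝 (g α.toUltrafilter)) :=
        (g.continuous.tendsto _).comp (Ultrafilter.tendsto_pure_self _)
      have h2 : g α.toUltrafilter = f α := congrFun hg (⟨α, hα⟩ : C)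
      rw [h2] at h1
      refine h1.congr' ?_
      filter_upwards [hα] with p hp
      rw [if_pos hp]
    · have h0 : f α = 0 := by
        by_contra h0
        exact hα (hfS α (subset_closure h0))
      rw [h0]
      refine tendsto_const_nhds.congr' ?_
      filter_upwards [Ultrafilter.compl_mem_iff_notMem.2 hα] with p hp
      rw [if_neg hp]

/-- Normalising two non-negative functions of finite support changes their distance at most by
a factor of two over the norm. -/
theorem tsum_abs_div_sub_div_le {A : Type*} {u v : A → ℝ} (hu : (Function.support u).Finite)
    (hv : (Function.support v).Finite) (hv0 : ∀ z, 0 ≤ v z)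
    (hsu : 0 < ∑' z, u z) (hsv : 0 < ∑' z, v z) :
    Summable (fun z => |u z / (∑' z, u z) - v z / (∑' z, v z)|) ∧
    ∑' z, |u z / (∑' z, u z) - v z / (∑' z, v z)| ≤ 2 * (∑' z, |u z - v z|) / ∑' z, u z := by
  have hus : Summable u := summable_of_hasFiniteSupport hu
  have hvs : Summable v := summable_of_hasFiniteSupport hv
  have hds := (hus.sub hvs).abs
  set a := ∑' z, u z with ha
  set b := ∑' z, v z with hb
  set d := ∑' z, |u z - v z| with hd
  have hab : |b - a| ≤ d := by
    have h1 : |∑' z, (u z - v z)| ≤ d := by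
      have := norm_tsum_le_tsum_norm (f := fun z => u z - v z) hds
      simpa [Real.norm_eq_abs] using this
    rw [hus.tsum_sub hvs] at h1
    rwa [abs_sub_comm]
  have hpt : ∀ z, |u z / a - v z / b| ≤ |u z - v z| * a⁻¹ + v z * (|b - a| * (a⁻¹ * b⁻¹)) := by
    intro z
    -- After summation the second term contributes `|b - a| / a`, which is at most the first
    -- contribution `d / a`; hence the factor two.
    have : u z / a - v z / b = (u z - v z) * a⁻¹ + v z * ((b - a) * (a⁻¹ * b⁻¹)) := by
      field_simp
      ring
    rw [this]
    refine (abs_add_le _ _).trans (le_of_eq ?_)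
    rw [abs_mul, abs_mul, abs_mul, abs_of_nonneg (hv0 z), abs_of_pos (inv_pos.2 hsu),
      abs_of_pos (mul_pos (inv_pos.2 hsu) (inv_pos.2 hsv))]
  have hs2 : Summable fun z => |u z - v z| * a⁻¹ + v z * (|b - a| * (a⁻¹ * b⁻¹)) :=
    (hds.mul_right _).add (hvs.mul_right _)
  refine ⟨Summable.of_nonneg_of_le (fun _ => abs_nonneg _) hpt hs2, ?_⟩
  refine ((Summable.of_nonneg_of_le (fun _ => abs_nonneg _) hpt hs2).tsum_le_tsum hpt hs2).trans ?_
  rw [(hds.mul_right _).tsum_add (hvs.mul_right _), tsum_mul_right, tsum_mul_right, ← hd, ← hb]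
  have : b * (|b - a| * (a⁻¹ * b⁻¹)) = |b - a| / a := by field_simp
  rw [this, ← div_eq_mul_inv, ← add_div]
  gcongr
  linarith

open Filter in
theorem functionCondition_of_hasPartialPropertyA (hX : BoundedGeometry X)
    {Z : Set (Ultrafilter X)} (hZc : IsClosed Z) (hZ : (coarseGroupoid X hX).IsInvariant Z)
    (h : HasPartialPropertyA X hX Z) : FunctionCondition Z := by
  classical
  intro ε hε R hR
  -- Normalising with column sums above `1/2` multiplies the error by at most four.
  obtain ⟨f, hf, hfc, hf01, hfK⟩ := h (ε / 4) (by positivity) _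
    (ReducedArrow.isCompact_setOf_mem hX hZc hR)
  obtain ⟨S, hS, F, hF01, hFS, hFf⟩ := ReducedArrow.exists_function_tendsto hZc hf hfc hf01
  have hfin := finite_support_of_subset_entourage hX hFS
  have hsm : ∀ x, Summable fun z => F (z, x) := fun x => summable_of_hasFiniteSupport (hfin x)
  let P : X × X → Prop := fun a => dist a.1 a.2 ≤ R →
    1 / 2 < ∑' z, F (z, a.1) ∧ ∑' z, |F (z, a.1) - F (z, a.2)| < ε / 4
  -- Tested on ultrafilters: one containing `E_R` is an arrow of the reduction, where amenability
  -- gives the strict estimates; any other satisfies `P` vacuously. Membership in the product filter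
  -- then yields the square `D × D`.
  have hP : {a | P a} ∈ closureFilter Z ×ˢ closureFilter Z := by
    rw [Filter.mem_iff_ultrafilter]
    intro p hp
    by_cases hpR : entourage X R ∈ p
    · have h1 : p.map Prod.fst ∈ Z := mem_of_le_closureFilter hZc
        ((Filter.map_mono hp).trans Filter.tendsto_fst)
      have h2 : p.map Prod.snd ∈ Z := mem_of_le_closureFilter hZc
        ((Filter.map_mono hp).trans Filter.tendsto_snd)
      obtain ⟨γ, rfl⟩ := ReducedArrow.exists_toUltrafilter_eq hX Z p hR hpR h1 h2
      obtain ⟨h3, -, h4⟩ := hfK γ hpR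
      obtain ⟨s, hs, hs'⟩ := ReducedArrow.hasSum_apply hZ hS F hFS f hFf γ
      obtain ⟨v, hv, hv'⟩ := ReducedArrow.hasSum_abs_sub hZ hS F hFS f hFf γ
      have hs1 : s = 1 := hs.unique h3
      have hv1 : v < ε / 4 := hv.tsum_eq ▸ h4
      filter_upwards [hs'.eventually (lt_mem_nhds (show 1 / 2 < s by rw [hs1]; norm_num)),
        hv'.eventually (gt_mem_nhds hv1)] with a ha hb _
      exact ⟨ha, hb⟩
    · filter_upwards [Ultrafilter.compl_mem_iff_notMem.2 hpR] with a ha hb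
      exact absurd hb ha
  obtain ⟨D, hD, hDP⟩ := Filter.mem_prod_self_iff.1 hP
  have hDP' : ∀ x ∈ D, ∀ y ∈ D, P (x, y) := fun x hx y hy => hDP (Set.mk_mem_prod hx hy)
  have hsum : ∀ x ∈ D, 1 / 2 < ∑' z, F (z, x) := fun x hx =>
    (hDP' x hx x hx (by simp [hR.le])).1
  refine ⟨S, hS, D, mem_closureFilter.1 hD,
    fun p => if p.2 ∈ D then F p / ∑' z, F (z, p.2) else 0, ?_, ?_, ?_, ?_⟩
  · rintro ⟨z, x⟩
    dsimp only
    split_ifs with hx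
    · have h1 := hsum x hx
      have h2 : F (z, x) ≤ ∑' z, F (z, x) :=
        (hsm x).le_tsum z fun w _ => (hF01 (w, x)).1
      exact ⟨div_nonneg (hF01 _).1 (by linarith), div_le_one_of_le₀ h2 (by linarith)⟩
    · simp
  · rintro ⟨z, x⟩ hp
    apply hFS
    intro h0
    apply hp
    simp [h0]
  · intro x hx
    simp only [if_pos hx]
    have h1 := hsum x hx
    have := (hsm x).hasSum.div_const (∑' z, F (z, x))
    rwa [div_self (by linarith)] at this
  · intro x hx y hy hxy
    simp only [if_pos hx, if_pos hy]
    have h1 := hsum x hx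
    obtain ⟨h2, h3⟩ := tsum_abs_div_sub_div_le (hfin x) (hfin y) (fun z => (hF01 _).1)
      (by linarith) (by linarith [hsum y hy])
    refine ⟨h2, h3.trans ?_⟩
    rw [div_le_iff₀ (by linarith)]
    have h4 := (hDP' x hx y hy hxy).2
    dsimp only at h4
    nlinarith

theorem Ultrafilter.isOpen_range_pure {A : Type*} : IsOpen (range (pure : A → Ultrafilter A)) := by
  have : range (pure : A → Ultrafilter A) = ⋃ x, {u : Ultrafilter A | {x} ∈ u} := by
    ext u
    simp only [mem_range, mem_iUnion, mem_ofPred_eq]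
    refine exists_congr fun x => ?_
    constructor
    · rintro rfl; exact Ultrafilter.mem_pure.2 rfl
    · intro h
      refine (Ultrafilter.coe_le_coe.1 ?_).symm
      rw [Ultrafilter.coe_pure]
      exact Filter.le_pure_iff.2 h
  rw [this]
  exact isOpen_iUnion fun x => ultrafilter_isOpen_basic _

theorem isClosed_betaBoundary_diff {A : Type*} {U : Set (Ultrafilter A)} (hU : IsOpen U) :
    IsClosed (betaBoundary A \ U) :=
  Ultrafilter.isOpen_range_pure.isClosed_compl.sdiff hU

/-- An arrow is a graph over its source, and the image of a principal ultrafilter is principal. -/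
theorem CoarseArrow.rng_mem_range_pure (hX : BoundedGeometry X) (γ : CoarseArrow X)
    (h : γ.src ∈ range (pure : X → Ultrafilter X)) : γ.rng ∈ range (pure : X → Ultrafilter X) := by
  obtain ⟨r, hr, hγ⟩ := CoarseArrow.mem_iff.1 γ.2
  obtain ⟨t, ht⟩ := Ultrafilter.eq_map_section hX hr hγ
  obtain ⟨x, hx⟩ := h
  have hx' : γ.1.map Prod.snd = pure x := hx.symm
  refine ⟨t x, ?_⟩
  change pure (t x) = γ.1.map Prod.fst
  rw [ht, hx', Ultrafilter.map_map, Ultrafilter.map_pure]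
  rfl

theorem isInvariant_betaBoundary (hX : BoundedGeometry X) :
    (coarseGroupoid X hX).IsInvariant (betaBoundary X) := by
  ext γ
  refine not_congr ⟨fun h => ?_, CoarseArrow.rng_mem_range_pure hX γ⟩
  have := CoarseArrow.rng_mem_range_pure hX γ.inv (by rw [CoarseArrow.src_inv]; exact h)
  rwa [CoarseArrow.rng_inv] at this

theorem isInvariant_betaBoundary_diff (hX : BoundedGeometry X) {U : Set (Ultrafilter X)}
    (hU : (coarseGroupoid X hX).IsInvariant U) :
    (coarseGroupoid X hX).IsInvariant (betaBoundary X \ U) := by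
  have h := isInvariant_betaBoundary hX
  unfold ArrowGroupoid.IsInvariant at h hU ⊢
  rw [preimage_sdiff, preimage_sdiff, h, hU]

theorem hasPartialPropertyA_iff_functionCondition (hX : BoundedGeometry X)
    {U : Set (Ultrafilter X)} (hUo : IsOpen U) (hUi : (coarseGroupoid X hX).IsInvariant U) :
    HasPartialPropertyA X hX (betaBoundary X \ U) ↔ FunctionCondition (betaBoundary X \ U) :=
  ⟨functionCondition_of_hasPartialPropertyA hX (isClosed_betaBoundary_diff hUo)
      (isInvariant_betaBoundary_diff hX hUi),
    hasPartialPropertyA_of_functionCondition hX (isClosed_betaBoundary_diff hUo)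
      (isInvariant_betaBoundary_diff hX hUi)⟩

end Function

/-! ### Functions on `X × X` as maps into `ℓ¹(X)` -/

section Lone

variable {X : Type*} [MetricSpace X]

theorem lp_one_hasSum_abs {A : Type*} (u : lp (fun _ : A => ℝ) 1) :
    HasSum (fun z => |u z|) ‖u‖ := by
  have := lp.hasSum_norm (p := 1) (by simp) u
  simpa using this

theorem functionCondition_iff_lp_one (Z : Set (Ultrafilter X)) :
    FunctionCondition Z ↔
      ∀ ε : ℝ, 0 < ε → ∀ R : ℝ, 0 < R →
        ∃ S : ℝ, 0 < S ∧ ∃ D : Set X, Z ⊆ betaClosure D ∧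
          ∃ ξ : D → lp (fun _ : X => ℝ) 1,
            (∀ x, ‖ξ x‖ = 1 ∧ ∀ z, 0 ≤ ξ x z) ∧
            (∀ x, Function.support (ξ x) ⊆ Metric.closedBall (x : X) S) ∧
            (∀ x y, dist x y ≤ R → ‖ξ x - ξ y‖ ≤ ε) := by
  classical
  constructor
  · intro h ε hε R hR
    obtain ⟨S, hS, D, hD, F, hF01, hFS, hF1, hFR⟩ := h ε hε R hR
    have hmem : ∀ x : D, Memℓp (fun z => F (z, x)) 1 := fun x => by
      refine memℓp_gen ?_
      simpa using (hF1 x x.2).summable.abs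
    let ξ : D → lp (fun _ : X => ℝ) 1 := fun x => ⟨fun z => F (z, x), hmem x⟩
    refine ⟨S, hS, D, hD, ξ, fun x => ⟨?_, fun z => (hF01 _).1⟩, fun x z hz => ?_, fun x y hxy => ?_⟩
    · refine (lp_one_hasSum_abs (ξ x)).unique ?_
      convert hF1 x x.2 using 2 with z
      exact abs_of_nonneg (hF01 _).1
    · exact hFS (a := (z, (x : X))) hz
    · rw [← (lp_one_hasSum_abs (ξ x - ξ y)).tsum_eq]
      exact (hFR x x.2 y y.2 hxy).2
  · intro h ε hε R hR
    obtain ⟨S, hS, D, hD, ξ, hξ1, hξS, hξR⟩ := h ε hε R hR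
    have hsum : ∀ x : D, HasSum (fun z => ξ x z) 1 := fun x => by
      have := lp_one_hasSum_abs (ξ x)
      rw [(hξ1 x).1] at this
      convert this using 2 with z
      exact (abs_of_nonneg ((hξ1 x).2 z)).symm
    refine ⟨S, hS, D, hD, fun p => if hp : p.2 ∈ D then ξ ⟨p.2, hp⟩ p.1 else 0, ?_, ?_, ?_, ?_⟩
    · rintro ⟨z, x⟩
      dsimp only
      split_ifs with hx
      · refine ⟨(hξ1 _).2 z, ?_⟩
        exact le_hasSum (hsum ⟨x, hx⟩) z fun w _ => (hξ1 _).2 w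
      · simp
    · rintro ⟨z, x⟩ hp
      by_cases hx : x ∈ D
      · simp only [Function.mem_support, dif_pos hx] at hp
        exact hξS ⟨x, hx⟩ hp
      · simp [hx] at hp
    · intro x hx
      simpa only [dif_pos hx] using hsum ⟨x, hx⟩
    · intro x hx y hy hxy
      simp only [dif_pos hx, dif_pos hy]
      have h1 := lp_one_hasSum_abs (ξ ⟨x, hx⟩ - ξ ⟨y, hy⟩)
      exact ⟨h1.summable, h1.tsum_eq.trans_le (hξR _ _ hxy)⟩

end Lone

/-! ### From the set `D` to the ideal of `U` -/

section Ideal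

variable {X : Type*} [MetricSpace X]

theorem mem_idealOf_iff {A : Type*} {U : Set (Ultrafilter A)} {Y : Set A} :
    Y ∈ idealOf U ↔ ∀ ω : Ultrafilter A, Y ∈ ω → ω ∈ U :=
  forall_congr' fun _ => by rw [mem_betaClosure_iff]

theorem betaBoundary_diff_subset_betaClosure_compl {A : Type*} {U : Set (Ultrafilter A)}
    {Y : Set A} (hY : Y ∈ idealOf U) : betaBoundary A \ U ⊆ betaClosure Yᶜ := fun ω hω =>
  mem_betaClosure_iff.2 (Ultrafilter.compl_mem_iff_notMem.2 fun h => hω.2 (mem_idealOf_iff.1 hY ω h))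

/-- Principal ultrafilters are dense and form a single orbit: the pair `(x₀, x)` is itself an arrow
from `x` to `x₀`. -/
theorem eq_empty_or_range_pure_subset (hX : BoundedGeometry X) {U : Set (Ultrafilter X)}
    (hUo : IsOpen U) (hUi : (coarseGroupoid X hX).IsInvariant U) :
    U = ∅ ∨ range (pure : X → Ultrafilter X) ⊆ U := by
  rcases U.eq_empty_or_nonempty with h | h
  · exact Or.inl h
  · right
    obtain ⟨x₀, hx₀⟩ := denseRange_pure.exists_mem_open hUo h
    rintro _ ⟨x, rfl⟩
    let γ : CoarseArrow X := ⟨pure (x₀, x), CoarseArrow.mem_iff.2 ⟨dist x₀ x + 1, by positivity,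
      Ultrafilter.mem_pure.2 (show dist x₀ x ≤ dist x₀ x + 1 by linarith)⟩⟩
    have h1 : γ ∈ (coarseGroupoid X hX).rng ⁻¹' U := by
      change (pure (x₀, x) : Ultrafilter (X × X)).map Prod.fst ∈ U
      rwa [Ultrafilter.map_pure]
    rw [hUi] at h1
    change (pure (x₀, x) : Ultrafilter (X × X)).map Prod.snd ∈ U at h1
    rwa [Ultrafilter.map_pure] at h1

theorem finite_compl_of_betaBoundary_subset {A : Type*} {D : Set A}
    (h : betaBoundary A ⊆ betaClosure D) : Dᶜ.Finite := by
  by_contra hinf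
  have hne : (Filter.cofinite ⊓ Filter.principal Dᶜ).NeBot :=
    Filter.cofinite_inf_principal_neBot_iff.2 hinf
  have hle := Ultrafilter.of_le (Filter.cofinite ⊓ Filter.principal Dᶜ)
  set ω := Ultrafilter.of (Filter.cofinite ⊓ Filter.principal Dᶜ)
  have h1 : Dᶜ ∈ ω := hle.trans inf_le_right (Filter.mem_principal_self _)
  refine Ultrafilter.compl_mem_iff_notMem.1 h1 (mem_betaClosure_iff.1 (h ?_))
  rintro ⟨a, ha⟩
  have h2 : ({a} : Set A)ᶜ ∈ ω := hle.trans inf_le_left (Set.finite_singleton a).compl_mem_cofinite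
  rw [← ha] at h2
  exact Ultrafilter.mem_pure.1 h2 rfl

/-- A bump function, constantly one on a ball and with small Lipschitz constant. -/
theorem exists_bump (x₀ : X) (C : ℝ) {L : ℝ} (hL : 0 < L) :
    ∃ φ : X → ℝ, (∀ x, φ x ∈ Icc (0 : ℝ) 1) ∧ (∀ x, dist x x₀ ≤ C → φ x = 1) ∧
      (∀ x, φ x ≠ 0 → dist x x₀ ≤ C + L) ∧ ∀ x y, |φ x - φ y| ≤ dist x y / L := by
  refine ⟨fun x => max 0 (min 1 (1 - (dist x x₀ - C) / L)), fun x => ⟨le_max_left _ _,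
    max_le zero_le_one (min_le_left _ _)⟩, fun x hx => ?_, fun x hx => ?_, fun x y => ?_⟩
  · have : (dist x x₀ - C) / L ≤ 0 := div_nonpos_of_nonpos_of_nonneg (by linarith) hL.le
    dsimp only
    rw [min_eq_left (by linarith), max_eq_right zero_le_one]
  · by_contra hn
    apply hx
    have : 1 ≤ (dist x x₀ - C) / L := (one_le_div hL).2 (by linarith)
    exact max_eq_left ((min_le_right _ _).trans (by linarith))
  · refine (abs_max_sub_max_le_max _ _ _ _).trans (max_le (by simp; positivity) ?_)
    refine (abs_min_sub_min_le_max _ _ _ _).trans (max_le (by simp; positivity) ?_)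
    have : 1 - (dist x x₀ - C) / L - (1 - (dist y x₀ - C) / L) = (dist y x₀ - dist x x₀) / L := by
      field_simp
      ring
    rw [this, abs_div, abs_of_pos hL]
    gcongr
    rw [dist_comm x y]
    exact abs_dist_sub_le _ _ _

/-- Functions as in the description of Property A, given outside a bounded set, can be replaced by
functions on the whole space. -/
theorem exists_function_univ {ε R S : ℝ} (hε : 0 < ε) (hR : 0 < R)
    (hS : 0 < S) {D : Set X} (x₀ : X) {C : ℝ} (hD : ∀ x ∉ D, dist x x₀ ≤ C) (F : X × X → ℝ)
    (hF01 : ∀ p, F p ∈ Set.Icc (0 : ℝ) 1) (hFS : Function.support F ⊆ entourage X S)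
    (hF1 : ∀ x ∈ D, HasSum (fun z => F (z, x)) 1)
    (hFR : ∀ x ∈ D, ∀ y ∈ D, dist x y ≤ R → ∑' z, |F (z, x) - F (z, y)| ≤ ε / 2) :
    ∃ S' : ℝ, 0 < S' ∧ ∃ f : X × X → ℝ, (∀ p, f p ∈ Set.Icc (0 : ℝ) 1) ∧
      Function.support f ⊆ entourage X S' ∧ (∀ x, HasSum (fun z => f (z, x)) 1) ∧
      ∀ x y, dist x y ≤ R → ∑' z, |f (z, x) - f (z, y)| ≤ ε := by
  classical
  -- The columns are interpolated between the point mass at `x₀` and `F`. At distance `R` the bump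
  -- varies by at most `ε / 6`, which multiplies a total mass of at most three; the other `ε / 2`
  -- pays for `F`.
  obtain ⟨φ, hφ01, hφ1, hφ0, hφL⟩ := exists_bump x₀ C (L := 6 * R / ε) (by positivity)
  let F₀ : X × X → ℝ := fun p => if p.2 ∈ D then F p else 0
  let δ : X → ℝ := fun z => if z = x₀ then 1 else 0
  have hδ : HasSum δ 1 := hasSum_ite_eq x₀ 1
  have hδ01 : ∀ z, δ z ∈ Icc (0 : ℝ) 1 := fun z => by
    by_cases hz : z = x₀ <;> simp [δ, hz]
  have hF₀01 : ∀ p, F₀ p ∈ Icc (0 : ℝ) 1 := fun p => by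
    by_cases hp : p.2 ∈ D
    · simpa [F₀, hp] using hF01 p
    · simp [F₀, hp]
  have hF₀sum : ∀ x, ∃ s ≤ 1, HasSum (fun z => F₀ (z, x)) s ∧ (1 - φ x) * s = 1 - φ x := by
    intro x
    by_cases hx : x ∈ D
    · exact ⟨1, le_rfl, by simpa [F₀, hx] using hF1 x hx, mul_one _⟩
    · exact ⟨0, zero_le_one, by simp [F₀, hx, hasSum_zero], by rw [hφ1 x (hD x hx)]; simp⟩
  refine ⟨max S (C + 6 * R / ε), lt_max_of_lt_left hS,
    fun p => φ p.2 * δ p.1 + (1 - φ p.2) * F₀ p, ?_, ?_, ?_, ?_⟩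
  · intro p
    exact (convex_Icc (0 : ℝ) 1) (hδ01 p.1) (hF₀01 p) (hφ01 p.2).1 (by linarith [(hφ01 p.2).2])
      (by ring)
  · rintro ⟨z, x⟩ hp
    by_cases hz : φ x * δ z = 0
    · have h1 : F₀ (z, x) ≠ 0 := fun h => hp (by simp [hz, h])
      have h2 : F (z, x) ≠ 0 := fun h => h1 (by simp [F₀, h])
      have h3 : dist z x ≤ S := hFS h2
      exact h3.trans (le_max_left S (C + 6 * R / ε))
    · have h1 : φ x ≠ 0 := left_ne_zero_of_mul hz
      have h2 : z = x₀ := by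
        by_contra h
        exact right_ne_zero_of_mul hz (by simp [δ, h])
      rw [h2]
      exact (dist_comm x₀ x).trans_le ((hφ0 x h1).trans (le_max_right S (C + 6 * R / ε)))
  · intro x
    obtain ⟨s, -, hs, hs'⟩ := hF₀sum x
    have := (hδ.mul_left (φ x)).add (hs.mul_left (1 - φ x))
    rw [hs'] at this
    simpa using this
  · intro x y hxy
    obtain ⟨s, hs1, hs, -⟩ := hF₀sum x
    obtain ⟨s', hs1', hs', -⟩ := hF₀sum y
    have hφxy : |φ x - φ y| ≤ ε / 6 := by
      refine (hφL x y).trans ?_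
      rw [div_le_iff₀ (by positivity)]
      have : ε / 6 * (6 * R / ε) = R := by field_simp
      linarith
    obtain ⟨v, hv, g, hg0, hg, hgD⟩ : ∃ v ≤ ε / 2, ∃ g : X → ℝ, (∀ z, 0 ≤ g z) ∧ HasSum g v ∧
        (x ∈ D → y ∈ D → ∀ z, |F (z, x) - F (z, y)| ≤ g z) := by
      by_cases h : x ∈ D ∧ y ∈ D
      · exact ⟨_, hFR x h.1 y h.2 hxy, _, fun _ => abs_nonneg _,
          ((hF1 x h.1).summable.sub (hF1 y h.2).summable).abs.hasSum, fun _ _ _ => le_rfl⟩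
      · exact ⟨0, by positivity, fun _ => 0, fun _ => le_rfl, hasSum_zero,
          fun h1 h2 => absurd ⟨h1, h2⟩ h⟩
    have hbound : HasSum (fun z => |φ x - φ y| * (δ z + F₀ (z, x) + F₀ (z, y)) + g z)
        (|φ x - φ y| * (1 + s + s') + v) := (((hδ.add hs).add hs').mul_left _).add hg
    have hpt : ∀ z, |φ x * δ z + (1 - φ x) * F₀ (z, x) - (φ y * δ z + (1 - φ y) * F₀ (z, y))| ≤
        |φ x - φ y| * (δ z + F₀ (z, x) + F₀ (z, y)) + g z := by
      intro z
      have hd0 := (hδ01 z).1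
      have hx0 := (hF₀01 (z, x)).1
      have hy0 := (hF₀01 (z, y)).1
      -- Outside `D` the bump is one, so a term with a missing column has weight zero and the
      -- remaining weight is a difference of values of `φ`.
      have key : |(1 - φ x) * F₀ (z, x) - (1 - φ y) * F₀ (z, y)| ≤
          |φ x - φ y| * (F₀ (z, x) + F₀ (z, y)) + g z := by
        by_cases hx : x ∈ D
        · by_cases hy : y ∈ D
          · have h1 : (1 - φ x) * F₀ (z, x) - (1 - φ y) * F₀ (z, y) =
              (φ y - φ x) * F₀ (z, x) + (1 - φ y) * (F (z, x) - F (z, y)) := by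
              simp only [F₀, if_pos hx, if_pos hy]; ring
            rw [h1]
            refine (abs_add_le _ _).trans ?_
            rw [abs_mul, abs_mul, abs_sub_comm, abs_of_nonneg hx0,
              abs_of_nonneg (show 0 ≤ 1 - φ y by linarith [(hφ01 y).2])]
            have h2 := hgD hx hy z
            have h3 : (1 - φ y) * |F (z, x) - F (z, y)| ≤ 1 * |F (z, x) - F (z, y)| :=
              mul_le_mul_of_nonneg_right (by linarith [(hφ01 y).1]) (abs_nonneg _)
            have h4 := mul_nonneg (abs_nonneg (φ x - φ y)) hy0
            linarith
          · have h1 : (1 - φ x) * F₀ (z, x) - (1 - φ y) * F₀ (z, y) =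
                (φ y - φ x) * F₀ (z, x) := by
              rw [hφ1 y (hD y hy)]; ring
            rw [h1, abs_mul, abs_sub_comm, abs_of_nonneg hx0]
            have h4 := mul_nonneg (abs_nonneg (φ x - φ y)) hy0
            linarith [hg0 z]
        · have h1 : (1 - φ x) * F₀ (z, x) - (1 - φ y) * F₀ (z, y) =
              (φ y - φ x) * F₀ (z, y) := by
            rw [hφ1 x (hD x hx)]; ring
          rw [h1, abs_mul, abs_sub_comm, abs_of_nonneg hy0]
          have h4 := mul_nonneg (abs_nonneg (φ x - φ y)) hx0
          linarith [hg0 z]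
      have h1 : φ x * δ z + (1 - φ x) * F₀ (z, x) - (φ y * δ z + (1 - φ y) * F₀ (z, y)) =
          (φ x - φ y) * δ z + ((1 - φ x) * F₀ (z, x) - (1 - φ y) * F₀ (z, y)) := by ring
      rw [h1]
      refine (abs_add_le _ _).trans ?_
      rw [abs_mul, abs_of_nonneg hd0]
      linarith
    have hsumm := Summable.of_nonneg_of_le (fun _ => abs_nonneg _) hpt hbound.summable
    refine (hsumm.tsum_le_tsum hpt hbound.summable).trans ?_
    rw [hbound.tsum_eq]
    nlinarith [abs_nonneg (φ x - φ y)]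

/-- In the description of partial Property A by functions, `D` can be taken to be the complement
of a set in the ideal. -/
theorem FunctionCondition.exists_mem_idealOf (hX : BoundedGeometry X) {U : Set (Ultrafilter X)}
    (hUo : IsOpen U) (hUi : (coarseGroupoid X hX).IsInvariant U)
    (h : FunctionCondition (betaBoundary X \ U)) {ε R : ℝ} (hε : 0 < ε) (hR : 0 < R) :
    ∃ S : ℝ, 0 < S ∧ ∃ Y ∈ idealOf U, ∃ f : X × X → ℝ, (∀ p, f p ∈ Set.Icc (0 : ℝ) 1) ∧
      Function.support f ⊆ entourage X S ∧ (∀ x ∉ Y, HasSum (fun z => f (z, x)) 1) ∧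
      ∀ x ∉ Y, ∀ y ∉ Y, dist x y ≤ R → ∑' z, |f (z, x) - f (z, y)| ≤ ε := by
  obtain ⟨S, hS, D, hD, F, hF01, hFS, hF1, hFR⟩ := h (ε / 2) (by positivity) R hR
  rcases eq_empty_or_range_pure_subset hX hUo hUi with hU | hU
  -- For empty `U` only the empty set is in the ideal, so the function must be repaired on the
  -- finite set `Dᶜ`.
  · have hfin : Dᶜ.Finite := finite_compl_of_betaBoundary_subset (by simpa [hU] using hD)
    rcases isEmpty_or_nonempty X with hXe | ⟨⟨x₀⟩⟩
    · refine ⟨S, hS, ∅, mem_idealOf_iff.2 fun ω hω => ?_, F, hF01, hFS, fun x => isEmptyElim x,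
        fun x => isEmptyElim x⟩
      exact absurd hω ω.empty_notMem
    · obtain ⟨C, hC⟩ := hfin.isBounded.subset_closedBall x₀
      obtain ⟨S', hS', f, h1, h2, h3, h4⟩ := exists_function_univ hε hR hS x₀ (C := C)
        (fun x hx => hC hx) F hF01 hFS hF1 fun x hx y hy hxy => (hFR x hx y hy hxy).2
      refine ⟨S', hS', ∅, mem_idealOf_iff.2 fun ω hω => ?_, f, h1, h2, fun x _ => h3 x,
        fun x _ y _ => h4 x y⟩
      exact absurd hω ω.empty_notMem
  · refine ⟨S, hS, Dᶜ, mem_idealOf_iff.2 fun ω hω => ?_, F, hF01, hFS,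
      fun x hx => hF1 x (notMem_compl_iff.1 hx), fun x hx y hy hxy =>
        ((hFR x (notMem_compl_iff.1 hx) y (notMem_compl_iff.1 hy) hxy).2).trans (by linarith)⟩
    by_contra hωU
    exact Ultrafilter.compl_mem_iff_notMem.1 hω
      (mem_betaClosure_iff.1 (hD ⟨fun hr => hωU (hU hr), hωU⟩))

end Ideal

/-! ### Polynomial approximation of a square root in a normed algebra -/

section Approximation

/-- The iteration `g ↦ (a + g²) / 2`, whose limit is `1 - √(1 - a)`. -/
noncomputable def oneSubSqrtSeq {B : Type*} [NormedRing B] [NormedAlgebra ℝ B] (a : B) : ℕ → B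
  | 0 => 0
  | n + 1 => (1 / 2 : ℝ) • (a + oneSubSqrtSeq a n * oneSubSqrtSeq a n)

theorem oneSubSqrtSeq_one_mem (n : ℕ) : oneSubSqrtSeq (1 : ℝ) n ∈ Icc (0 : ℝ) 1 := by
  induction n with
  | zero => simp [oneSubSqrtSeq]
  | succ n ih =>
    simp only [oneSubSqrtSeq, smul_eq_mul]
    constructor <;> nlinarith [ih.1, ih.2]

theorem oneSubSqrtSeq_one_monotone : Monotone (oneSubSqrtSeq (1 : ℝ)) := by
  refine monotone_nat_of_le_succ fun n => ?_
  simp only [oneSubSqrtSeq, smul_eq_mul]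
  nlinarith [sq_nonneg (oneSubSqrtSeq (1 : ℝ) n - 1)]

variable {B : Type*} [NormedRing B] [NormedAlgebra ℝ B]

theorem norm_oneSubSqrtSeq_le {a : B} (ha : ‖a‖ ≤ 1) (n : ℕ) :
    ‖oneSubSqrtSeq a n‖ ≤ oneSubSqrtSeq (1 : ℝ) n := by
  induction n with
  | zero => simp [oneSubSqrtSeq]
  | succ n ih =>
    simp only [oneSubSqrtSeq, smul_eq_mul]
    rw [norm_smul, Real.norm_of_nonneg (by norm_num)]
    have h := (norm_add_le a (oneSubSqrtSeq a n * oneSubSqrtSeq a n)).trans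
      (add_le_add ha ((norm_mul_le _ _).trans
        (mul_le_mul ih ih (norm_nonneg _) (oneSubSqrtSeq_one_mem n).1)))
    linarith

/-- The scalar sequence at `a = 1` majorises the increments: the recursion has non-negative
coefficients, and `g² - h² = g(g - h) + (g - h)h` needs no commutativity. -/
theorem norm_oneSubSqrtSeq_succ_sub_le {a : B} (ha : ‖a‖ ≤ 1) (n : ℕ) :
    ‖oneSubSqrtSeq a (n + 1) - oneSubSqrtSeq a n‖ ≤
      oneSubSqrtSeq (1 : ℝ) (n + 1) - oneSubSqrtSeq (1 : ℝ) n := by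
  induction n with
  | zero =>
    have h := norm_oneSubSqrtSeq_le ha 1
    simpa [oneSubSqrtSeq] using h
  | succ n ih =>
    have h1 := norm_oneSubSqrtSeq_le ha (n + 1)
    have h2 := norm_oneSubSqrtSeq_le ha n
    rw [oneSubSqrtSeq.eq_2 a (n + 1), oneSubSqrtSeq.eq_2 (1 : ℝ) (n + 1)]
    have hg : oneSubSqrtSeq a (n + 1) =
      (1 / 2 : ℝ) • (a + oneSubSqrtSeq a n * oneSubSqrtSeq a n) := rfl
    have hs : oneSubSqrtSeq (1 : ℝ) (n + 1) =
      (1 / 2 : ℝ) • (1 + oneSubSqrtSeq (1 : ℝ) n * oneSubSqrtSeq (1 : ℝ) n) := rfl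
    set g := oneSubSqrtSeq a (n + 1)
    set h := oneSubSqrtSeq a n
    set s := oneSubSqrtSeq (1 : ℝ) (n + 1)
    set t := oneSubSqrtSeq (1 : ℝ) n
    have e : (1 / 2 : ℝ) • (a + g * g) - g =
        (1 / 2 : ℝ) • (g * (g - h) + (g - h) * h) := by
      conv_lhs => arg 2; rw [hg]
      rw [← smul_sub]
      congr 1
      noncomm_ring
    rw [e, norm_smul, Real.norm_of_nonneg (by norm_num)]
    have h0 : 0 ≤ s := (norm_nonneg _).trans h1
    have h3 : ‖g * (g - h)‖ ≤ s * (s - t) :=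
      (norm_mul_le _ _).trans (mul_le_mul h1 ih (norm_nonneg _) h0)
    have h4 : ‖(g - h) * h‖ ≤ (s - t) * t :=
      (norm_mul_le _ _).trans (mul_le_mul ih h2 (norm_nonneg _) ((norm_nonneg _).trans ih))
    have h5 := norm_add_le (g * (g - h)) ((g - h) * h)
    simp only [smul_eq_mul] at hs ⊢
    linarith

/-- The residual is exactly twice an increment of the sequence, and the scalar increments tend to
zero since that sequence is monotone and bounded. No limit in `B`, hence no completeness, is needed.
-/
theorem exists_norm_sq_sub_le {a : B} (ha : ‖a‖ ≤ 1) {δ : ℝ} (hδ : 0 < δ) :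
    ∃ n, ‖(1 - oneSubSqrtSeq a n) * (1 - oneSubSqrtSeq a n) - (1 - a)‖ ≤ δ := by
  have hlim := tendsto_atTop_ciSup oneSubSqrtSeq_one_monotone
    ⟨1, by rintro _ ⟨n, rfl⟩; exact (oneSubSqrtSeq_one_mem n).2⟩
  have h0 := ((hlim.comp (Filter.tendsto_add_atTop_nat 1)).sub hlim)
  rw [sub_self] at h0
  obtain ⟨n, hn⟩ := (h0.eventually (gt_mem_nhds (show 0 < δ / 2 by positivity))).exists
  refine ⟨n, ?_⟩
  have e : (1 - oneSubSqrtSeq a n) * (1 - oneSubSqrtSeq a n) - (1 - a) =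
      (2 : ℝ) • (oneSubSqrtSeq a (n + 1) - oneSubSqrtSeq a n) := by
    rw [oneSubSqrtSeq, smul_sub, smul_smul]
    norm_num
    rw [two_smul]
    noncomm_ring
  rw [e, norm_smul, Real.norm_of_nonneg (by norm_num)]
  have h1 := norm_oneSubSqrtSeq_succ_sub_le ha n
  have h2 : oneSubSqrtSeq (1 : ℝ) (n + 1) - oneSubSqrtSeq (1 : ℝ) n < δ / 2 := hn
  linarith

end Approximation

/-! ### Two estimates in inner product spaces -/

section Hilbert

variable {E : Type*} [NormedAddCommGroup E] [InnerProductSpace ℝ E]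

open scoped InnerProductSpace

theorem norm_one_sub_smul_le_one {T : E →L[ℝ] E} (hsymm : ∀ v w, ⟪T v, w⟫_ℝ = ⟪v, T w⟫_ℝ)
    (hpos : ∀ v, 0 ≤ ⟪T v, v⟫_ℝ) {M : ℝ} (hM : 0 < M) (hT : ‖T‖ ≤ M) :
    ‖1 - M⁻¹ • T‖ ≤ 1 := by
  refine ContinuousLinearMap.opNorm_le_bound _ zero_le_one fun v => ?_
  rw [one_mul]
  refine le_of_sq_le_sq ?_ (norm_nonneg _)
  change ‖v - M⁻¹ • T v‖ ^ 2 ≤ ‖v‖ ^ 2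
  -- Positivity at this vector yields `‖T v‖² ≤ M ⟪T v, v⟫`, which is what the expansion of `‖v -
  -- M⁻¹ T v‖²` requires.
  have h1 := hpos (v - M⁻¹ • T v)
  have h2 : ⟪T (T v), T v⟫_ℝ ≤ M * ‖T v‖ ^ 2 := by
    refine (real_inner_le_norm _ _).trans ?_
    have := (T.le_opNorm (T v)).trans (mul_le_mul_of_nonneg_right hT (norm_nonneg _))
    nlinarith [norm_nonneg (T v)]
  rw [map_sub, map_smul, inner_sub_left, inner_sub_right, inner_sub_right, inner_smul_left,
    inner_smul_right, inner_smul_left, inner_smul_right, hsymm (T v) v,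
    real_inner_self_eq_norm_sq] at h1
  rw [norm_sub_sq_real, inner_smul_right, norm_smul, Real.norm_of_nonneg (inv_nonneg.2 hM.le),
    real_inner_comm]
  simp only [conj_trivial] at h1
  have h3 := mul_le_mul_of_nonneg_left h2 (show 0 ≤ M⁻¹ * M⁻¹ by positivity)
  have h4 : M⁻¹ * M⁻¹ * (M * ‖T v‖ ^ 2) = M⁻¹ * ‖T v‖ ^ 2 := by field_simp
  have h5 : M⁻¹ * ‖T v‖ ^ 2 ≤ ⟪T v, v⟫_ℝ := by nlinarith
  have h6 := mul_le_mul_of_nonneg_left h5 (show 0 ≤ M⁻¹ by positivity)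
  have h7 : 0 ≤ M⁻¹ * ⟪T v, v⟫_ℝ := mul_nonneg (by positivity) (hpos v)
  nlinarith

theorem norm_normalize_sub_le {u v : E} (hu : u ≠ 0) (hv : v ≠ 0) :
    ‖‖u‖⁻¹ • u - ‖v‖⁻¹ • v‖ ≤ 2 * ‖u - v‖ / ‖u‖ := by
  have hu' := norm_pos_iff.2 hu
  have hv' := norm_pos_iff.2 hv
  have e : ‖u‖⁻¹ • u - ‖v‖⁻¹ • v = ‖u‖⁻¹ • (u - v) + (‖u‖⁻¹ - ‖v‖⁻¹) • v := by
    rw [smul_sub, sub_smul]; abel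
  rw [e]
  refine (norm_add_le _ _).trans ?_
  rw [norm_smul, norm_smul, norm_inv, norm_norm]
  have h1 : ‖‖u‖⁻¹ - ‖v‖⁻¹‖ * ‖v‖ = |‖v‖ - ‖u‖| / ‖u‖ := by
    have : ‖u‖⁻¹ - ‖v‖⁻¹ = (‖v‖ - ‖u‖) / (‖u‖ * ‖v‖) := by field_simp
    rw [this, Real.norm_eq_abs, abs_div, abs_of_pos (mul_pos hu' hv')]
    field_simp
  rw [h1, inv_mul_eq_div, ← add_div]
  gcongr
  have := abs_norm_sub_norm_le v u
  rw [norm_sub_rev] at this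
  linarith

end Hilbert

/-! ### Operators on `ℓ²` given by kernels -/

section Ltwo

variable {A : Type*}

open scoped InnerProductSpace

theorem memℓp_two_iff_summable_sq {f : A → ℝ} :
    Memℓp (E := fun _ : A => ℝ) f 2 ↔ Summable fun z => f z ^ 2 := by
  rw [memℓp_gen_iff (by simp)]
  simp

theorem lp_two_hasSum_sq (u : lp (fun _ : A => ℝ) 2) : HasSum (fun z => u z ^ 2) (‖u‖ ^ 2) := by
  have := lp.hasSum_norm (p := 2) (by simp) u
  simpa using this

/-- The pointwise absolute value of an element of `ℓ²`. -/
noncomputable def lpTwoAbs (u : lp (fun _ : A => ℝ) 2) : lp (fun _ : A => ℝ) 2 :=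
  ⟨fun z => |u z|, memℓp_two_iff_summable_sq.2 (by
    simpa only [sq_abs] using (lp_two_hasSum_sq u).summable)⟩

theorem lpTwoAbs_apply (u : lp (fun _ : A => ℝ) 2) (z : A) : lpTwoAbs u z = |u z| := rfl

theorem norm_lpTwoAbs (u : lp (fun _ : A => ℝ) 2) : ‖lpTwoAbs u‖ = ‖u‖ := by
  have h := lp_two_hasSum_sq (lpTwoAbs u)
  simp only [lpTwoAbs_apply, sq_abs] at h
  exact (sq_eq_sq₀ (norm_nonneg _) (norm_nonneg _)).1 (h.unique (lp_two_hasSum_sq u))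

theorem norm_lpTwoAbs_sub_le (u v : lp (fun _ : A => ℝ) 2) :
    ‖lpTwoAbs u - lpTwoAbs v‖ ≤ ‖u - v‖ := by
  refine le_of_sq_le_sq (hasSum_le (fun z => ?_) (lp_two_hasSum_sq (lpTwoAbs u - lpTwoAbs v))
    (lp_two_hasSum_sq (u - v))) (norm_nonneg _)
  simp only [lp.coeFn_sub, Pi.sub_apply, lpTwoAbs_apply]
  exact sq_le_sq.2 (abs_abs_sub_abs_le _ _)

variable [MetricSpace A]

/-- The ball as a finite set. -/
noncomputable def BoundedGeometry.ball (hA : BoundedGeometry A) (S : ℝ) (x : A) : Finset A :=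
  (hA.finite_closedBall x S).toFinset

theorem BoundedGeometry.mem_ball {hA : BoundedGeometry A} {S : ℝ} {x y : A} :
    y ∈ hA.ball S x ↔ dist y x ≤ S := by
  simp [BoundedGeometry.ball]

theorem BoundedGeometry.exists_card_ball_le (hA : BoundedGeometry A) {S : ℝ} (hS : 0 < S) :
    ∃ N : ℕ, ∀ x, (hA.ball S x).card ≤ N := by
  obtain ⟨N, hN⟩ := hA S hS
  refine ⟨N, fun x => ?_⟩
  have := hN x
  rw [(hA.finite_closedBall x S).encard_eq_coe_toFinset_card] at this
  exact_mod_cast this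

/-- The Schur test for a bounded kernel of finite propagation. -/
theorem sum_sq_sum_ball_le (hA : BoundedGeometry A) {S : ℝ} {N : ℕ}
    (hN : ∀ x, (hA.ball S x).card ≤ N) {k : A → A → ℝ} (hk : ∀ x y, |k x y| ≤ 1)
    (v : lp (fun _ : A => ℝ) 2) (F : Finset A) :
    ∑ x ∈ F, (∑ y ∈ hA.ball S x, k x y * v y) ^ 2 ≤ (N * ‖v‖) ^ 2 := by
  classical
  -- Cauchy–Schwarz on a ball gives one factor `N`; exchanging the sums gives the other, as each `y`
  -- lies in at most `N` balls.
  have h1 : ∀ x, (∑ y ∈ hA.ball S x, k x y * v y) ^ 2 ≤ N * ∑ y ∈ hA.ball S x, v y ^ 2 := by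
    intro x
    refine sq_sum_le_card_mul_sum_sq.trans (mul_le_mul (by exact_mod_cast hN x)
      (Finset.sum_le_sum fun y _ => ?_) (Finset.sum_nonneg fun _ _ => sq_nonneg _) (by positivity))
    rw [mul_pow]
    have : k x y ^ 2 ≤ 1 := (sq_le_one_iff_abs_le_one _).2 (hk x y)
    nlinarith [sq_nonneg (v y)]
  have h2 : ∑ x ∈ F, ∑ y ∈ hA.ball S x, v y ^ 2 ≤ N * ‖v‖ ^ 2 := by
    rw [Finset.sum_comm' (t' := F.biUnion (hA.ball S)) (s' := fun y => F.filter fun x =>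
      y ∈ hA.ball S x) (by
        intro x y
        simp only [Finset.mem_filter, Finset.mem_biUnion]
        exact ⟨fun h => ⟨h, x, h⟩, fun h => h.1⟩)]
    simp only [Finset.sum_const, nsmul_eq_mul]
    calc ∑ y ∈ F.biUnion (hA.ball S), ((F.filter fun x => y ∈ hA.ball S x).card : ℝ) * v y ^ 2
        ≤ ∑ y ∈ F.biUnion (hA.ball S), (N : ℝ) * v y ^ 2 := by
          refine Finset.sum_le_sum fun y _ => mul_le_mul_of_nonneg_right ?_ (sq_nonneg _)
          have : (F.filter fun x => y ∈ hA.ball S x) ⊆ hA.ball S y := fun x hx => by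
            have := (Finset.mem_filter.1 hx).2
            rw [BoundedGeometry.mem_ball] at this ⊢
            rwa [dist_comm]
          exact_mod_cast (Finset.card_le_card this).trans (hN y)
      _ = N * ∑ y ∈ F.biUnion (hA.ball S), v y ^ 2 := by rw [Finset.mul_sum]
      _ ≤ N * ‖v‖ ^ 2 := by
          refine mul_le_mul_of_nonneg_left ?_ (by positivity)
          exact sum_le_hasSum _ (fun _ _ => sq_nonneg _) (lp_two_hasSum_sq v)
  calc ∑ x ∈ F, (∑ y ∈ hA.ball S x, k x y * v y) ^ 2
      ≤ ∑ x ∈ F, N * ∑ y ∈ hA.ball S x, v y ^ 2 := Finset.sum_le_sum fun x _ => h1 x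
    _ = N * ∑ x ∈ F, ∑ y ∈ hA.ball S x, v y ^ 2 := by rw [Finset.mul_sum]
    _ ≤ N * (N * ‖v‖ ^ 2) := mul_le_mul_of_nonneg_left h2 (by positivity)
    _ = (N * ‖v‖) ^ 2 := by ring

theorem exists_kernel_operator (hA : BoundedGeometry A) {S : ℝ} (hS : 0 < S) {k : A → A → ℝ}
    (hk : ∀ x y, |k x y| ≤ 1) :
    ∃ T : lp (fun _ : A => ℝ) 2 →L[ℝ] lp (fun _ : A => ℝ) 2,
      ∀ v x, T v x = ∑ y ∈ hA.ball S x, k x y * v y := by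
  obtain ⟨N, hN⟩ := hA.exists_card_ball_le hS
  have hsum : ∀ v : lp (fun _ : A => ℝ) 2,
      Summable fun x => (∑ y ∈ hA.ball S x, k x y * v y) ^ 2 := fun v =>
    summable_of_sum_le (fun _ => sq_nonneg _) (sum_sq_sum_ball_le hA hN hk v)
  let T₀ : lp (fun _ : A => ℝ) 2 →ₗ[ℝ] lp (fun _ : A => ℝ) 2 :=
    { toFun := fun v => ⟨fun x => ∑ y ∈ hA.ball S x, k x y * v y,
        memℓp_two_iff_summable_sq.2 (hsum v)⟩
      map_add' := fun v w => by
        ext x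
        simp only [lp.coeFn_add, Pi.add_apply, mul_add, Finset.sum_add_distrib]
      map_smul' := fun c v => by
        ext x
        simp [Finset.mul_sum, mul_left_comm] }
  refine ⟨T₀.mkContinuous N fun v => ?_, fun v x => rfl⟩
  refine le_of_sq_le_sq ?_ (by positivity)
  exact hasSum_le_of_sum_le (lp_two_hasSum_sq (T₀ v)) (sum_sq_sum_ball_le hA hN hk v)

end Ltwo

/-! ### Symmetric operators of finite propagation -/

section Propagation

variable {A : Type*} [MetricSpace A] [DecidableEq A]

open scoped InnerProductSpace

/-- Symmetric operators of finite propagation on `ℓ²`. -/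
def IsSymmetricFinitePropagation (T : lp (fun _ : A => ℝ) 2 →L[ℝ] lp (fun _ : A => ℝ) 2) : Prop :=
  (∀ v w, ⟪T v, w⟫_ℝ = ⟪v, T w⟫_ℝ) ∧
    ∃ r : ℝ, ∀ x z, T (lp.single 2 x (1 : ℝ)) z ≠ 0 → dist z x ≤ r

namespace IsSymmetricFinitePropagation

variable {T T' : lp (fun _ : A => ℝ) 2 →L[ℝ] lp (fun _ : A => ℝ) 2}

theorem zero :
    IsSymmetricFinitePropagation (0 : lp (fun _ : A => ℝ) 2 →L[ℝ] lp (fun _ : A => ℝ) 2) :=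
  ⟨fun v w => by simp, 0, fun x z h => absurd rfl h⟩

theorem one :
    IsSymmetricFinitePropagation (1 : lp (fun _ : A => ℝ) 2 →L[ℝ] lp (fun _ : A => ℝ) 2) :=
  ⟨fun v w => rfl, 0, fun x z h => by
    have : z = x := by
      by_contra hzx
      exact h (lp.single_apply_ne (E := fun _ : A => ℝ) 2 x 1 hzx)
    simp [this]⟩

theorem add (h : IsSymmetricFinitePropagation T) (h' : IsSymmetricFinitePropagation T') :
    IsSymmetricFinitePropagation (T + T') := by
  obtain ⟨h1, r, hr⟩ := h
  obtain ⟨h2, r', hr'⟩ := h'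
  refine ⟨fun v w => ?_, max r r', fun x z hz => ?_⟩
  · simp only [add_apply, inner_add_left, inner_add_right, h1, h2]
  · by_cases h0 : T (lp.single 2 x (1 : ℝ)) z = 0
    · refine (hr' x z fun h0' => hz ?_).trans (le_max_right _ _)
      change T (lp.single 2 x (1 : ℝ)) z + T' (lp.single 2 x (1 : ℝ)) z = 0
      rw [h0, h0', add_zero]
    · exact (hr x z h0).trans (le_max_left _ _)

theorem smul (h : IsSymmetricFinitePropagation T) (c : ℝ) :
    IsSymmetricFinitePropagation (c • T) := by
  obtain ⟨h1, r, hr⟩ := h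
  refine ⟨fun v w => ?_, r, fun x z hz => hr x z fun h0 => hz ?_⟩
  · simp only [smul_apply, real_inner_smul_left, real_inner_smul_right, h1]
  · change c * T (lp.single 2 x (1 : ℝ)) z = 0
    rw [h0, mul_zero]

theorem one_sub (h : IsSymmetricFinitePropagation T) : IsSymmetricFinitePropagation (1 - T) := by
  have := one.add (h.smul (-1))
  rwa [neg_one_smul, ← sub_eq_add_neg] at this

/-- By symmetry the matrix entry of `T²` at `(z, x)` is the inner product of the columns of `T` at
`z` and `x`, which have disjoint supports when `z` and `x` are far apart. -/
theorem mul_self (h : IsSymmetricFinitePropagation T) : IsSymmetricFinitePropagation (T * T) := by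
  obtain ⟨h1, r, hr⟩ := h
  refine ⟨fun v w => ?_, r + r, fun x z hz => ?_⟩
  · rw [mul_apply_eq_comp, mul_apply_eq_comp, h1, h1]
  · by_contra hd
    apply hz
    have h2 : (T * T) (lp.single 2 x (1 : ℝ)) z =
        ⟪lp.single 2 z (1 : ℝ), T (T (lp.single 2 x (1 : ℝ)))⟫_ℝ := by
      rw [lp.inner_single_left]
      simp
    rw [h2, ← h1, lp.inner_eq_tsum]
    refine (tsum_congr fun w => ?_).trans tsum_zero
    by_contra hw
    have h3 : T (lp.single 2 z (1 : ℝ)) w ≠ 0 := fun h0 => hw (by rw [h0, inner_zero_left])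
    have h4 : T (lp.single 2 x (1 : ℝ)) w ≠ 0 := fun h0 => hw (by rw [h0, inner_zero_right])
    exact hd ((dist_triangle_left z x w).trans (add_le_add (hr _ _ h3) (hr _ _ h4)))

theorem oneSubSqrtSeq (h : IsSymmetricFinitePropagation T) (n : ℕ) :
    IsSymmetricFinitePropagation (oneSubSqrtSeq T n) := by
  induction n with
  | zero => exact zero
  | succ n ih => exact (h.add ih.mul_self).smul _

end IsSymmetricFinitePropagation

end Propagation

/-! ### From kernels of positive type to unit vectors -/

section KernelOperator

variable {A : Type*} [MetricSpace A] [DecidableEq A]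

open scoped InnerProductSpace

theorem IsPositiveType.sum_nonneg {A : Type*} {k : A → A → ℝ} (hk : IsPositiveType k)
    (F : Finset A) (c : A → ℝ) : 0 ≤ ∑ x ∈ F, ∑ y ∈ F, c x * c y * k x y := by
  have h := hk F.card (fun i => (F.equivFin.symm i : A)) (fun i => c (F.equivFin.symm i))
  have e : ∀ g : A → ℝ, ∑ i, g (F.equivFin.symm i : A) = ∑ x ∈ F, g x := fun g => by
    rw [F.equivFin.symm.sum_comp (fun x : F => g x), Finset.sum_coe_sort F g]
  rw [e fun x => ∑ j, c x * c (F.equivFin.symm j) * k x (F.equivFin.symm j)] at h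
  refine h.trans_eq (Finset.sum_congr rfl fun x _ => ?_)
  exact e fun y => c x * c y * k x y

/-- Positivity on two points with coefficients `(1, 1)` and `(1, -1)`; this bound feeds the Schur
test. -/
theorem IsPositiveType.abs_le_one {A : Type*} {k : A → A → ℝ} (hk : IsPositiveType k)
    (hsymm : ∀ x y, k x y = k y x) (hk1 : ∀ x, k x x = 1) (x y : A) : |k x y| ≤ 1 := by
  have h1 := hk 2 ![x, y] ![1, 1]
  have h2 := hk 2 ![x, y] ![1, -1]
  simp [Fin.sum_univ_two, hk1, hsymm y x] at h1 h2
  rw [abs_le]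
  constructor <;> linarith

/-- Symmetry and positivity pass from the matrix `k` to the operator because finitely supported
vectors are dense and `T` is continuous. -/
theorem exists_positive_kernel_operator (hA : BoundedGeometry A) {S : ℝ} (hS : 0 < S)
    {k : A → A → ℝ} (hk : IsPositiveType k) (hsymm : ∀ x y, k x y = k y x)
    (hk1 : ∀ x, k x x = 1) (hk0 : ∀ x y, S ≤ dist x y → k x y = 0) :
    ∃ T : lp (fun _ : A => ℝ) 2 →L[ℝ] lp (fun _ : A => ℝ) 2,
      IsSymmetricFinitePropagation T ∧ (∀ v, 0 ≤ ⟪T v, v⟫_ℝ) ∧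
      ∀ x y, T (lp.single 2 x (1 : ℝ)) y = k y x := by
  obtain ⟨T, hT⟩ := exists_kernel_operator hA hS (hk.abs_le_one hsymm hk1)
  have hTe : ∀ x y, T (lp.single 2 x (1 : ℝ)) y = k y x := by
    intro x y
    rw [hT, Finset.sum_eq_single x]
    · rw [lp.single_apply_self (E := fun _ : A => ℝ), mul_one]
    · intro z _ hz
      rw [lp.single_apply_ne (E := fun _ : A => ℝ) 2 x 1 hz, mul_zero]
    · intro hx
      rw [BoundedGeometry.mem_ball, not_le] at hx
      rw [hk0 y x (by rw [dist_comm]; exact hx.le), zero_mul]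
  have hTs : ∀ x v, ⟪T (lp.single 2 x (1 : ℝ)), v⟫_ℝ = T v x := by
    intro x v
    rw [lp.inner_eq_tsum, hT, tsum_eq_sum (s := hA.ball S x)]
    · refine Finset.sum_congr rfl fun y _ => ?_
      rw [hTe, hsymm y x]
      simp [mul_comm]
    · intro y hy
      rw [BoundedGeometry.mem_ball, not_le] at hy
      rw [hTe, hk0 y x hy.le, inner_zero_left]
  have hsum : ∀ v : lp (fun _ : A => ℝ) 2, HasSum (fun x => v x • lp.single 2 x (1 : ℝ)) v := by
    intro v
    have := lp.hasSum_single (by simp) v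
    convert this using 2 with x
    rw [← lp.single_smul]
    simp
  have hTsymm : ∀ v w, ⟪T v, w⟫_ℝ = ⟪v, T w⟫_ℝ := by
    intro v w
    have h1 : HasSum (fun x => ⟪w, T (v x • lp.single 2 x (1 : ℝ))⟫_ℝ) ⟪w, T v⟫_ℝ :=
      (hsum v).mapL ((innerSL ℝ w).comp T)
    have h2 : HasSum (fun x => ⟪T w, v x • lp.single 2 x (1 : ℝ)⟫_ℝ) ⟪T w, v⟫_ℝ :=
      (hsum v).mapL (innerSL ℝ (T w))
    rw [real_inner_comm, real_inner_comm (T w) v]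
    refine h1.unique ?_
    convert h2 using 2 with x
    rw [map_smul, inner_smul_right, inner_smul_right, real_inner_comm, hTs, lp.inner_single_right]
    simp
  refine ⟨T, ⟨hTsymm, S, fun x z hz => ?_⟩, fun v => ?_, hTe⟩
  · rw [hTe] at hz
    by_contra hd
    exact hz (hk0 z x (not_le.1 hd).le)
  · have hlim : Filter.Tendsto (fun F : Finset A =>
        ⟪T (∑ x ∈ F, v x • lp.single 2 x (1 : ℝ)), ∑ x ∈ F, v x • lp.single 2 x (1 : ℝ)⟫_ℝ)
        Filter.atTop (𝓝 ⟪T v, v⟫_ℝ) :=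
      ((T.continuous.tendsto v).comp (hsum v)).inner (hsum v)
    refine ge_of_tendsto' hlim fun F => ?_
    refine (hk.sum_nonneg F v).trans_eq ?_
    rw [map_sum, sum_inner]
    refine Finset.sum_congr rfl fun x _ => ?_
    rw [inner_sum]
    refine Finset.sum_congr rfl fun y _ => ?_
    rw [map_smul, real_inner_smul_left, real_inner_smul_right, hTs, hTe]
    ring

/-- From kernels of positive type to vectors in `ℓ²`. -/
theorem exists_unit_vectors_of_kernel (hA : BoundedGeometry A) {S R ε : ℝ} (hS : 0 < S)
    (hε : 0 < ε) {k : A → A → ℝ} (hk : IsPositiveType k) (hsymm : ∀ x y, k x y = k y x)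
    (hk1 : ∀ x, k x x = 1) (hk0 : ∀ x y, S ≤ dist x y → k x y = 0)
    (hkR : ∀ x y, dist x y ≤ R → |1 - k x y| ≤ min (1 / 2) (ε ^ 2 / 48)) :
    ∃ S' : ℝ, 0 < S' ∧ ∃ ξ : A → lp (fun _ : A => ℝ) 2,
      (∀ x, ‖ξ x‖ = 1 ∧ ∀ z, 0 ≤ ξ x z) ∧
      (∀ x, Function.support (ξ x) ⊆ Metric.closedBall x S') ∧
      (∀ x y, dist x y ≤ R → ‖ξ x - ξ y‖ ≤ ε) := by
  obtain ⟨T, hT, hTpos, hTe⟩ := exists_positive_kernel_operator hA hS hk hsymm hk1 hk0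
  obtain ⟨M, hM, hTM⟩ : ∃ M, 0 < M ∧ ‖T‖ ≤ M :=
    ⟨‖T‖ + 1, by positivity, by linarith⟩
  -- The bound `1/2` keeps the squared norms of the columns above `1 / (2M)`. Their squared
  -- differences are at most `6η / M`, and normalising costs `4 · 2M`, which gives `48η ≤ ε²`.
  set η := min (1 / 2) (ε ^ 2 / 48) with hη
  have hη0 : 0 < η := lt_min (by norm_num) (by positivity)
  have hη1 : η ≤ 1 / 2 := min_le_left _ _
  have hη2 : η ≤ ε ^ 2 / 48 := min_le_right _ _
  obtain ⟨n, hn⟩ := exists_norm_sq_sub_le (norm_one_sub_smul_le_one hT.1 hTpos hM hTM)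
    (show 0 < η / M by positivity)
  have hg : IsSymmetricFinitePropagation (1 - oneSubSqrtSeq (1 - M⁻¹ • T) n) :=
    ((hT.smul M⁻¹).one_sub.oneSubSqrtSeq n).one_sub
  set g := 1 - oneSubSqrtSeq (1 - M⁻¹ • T) n
  rw [sub_sub_cancel] at hn
  obtain ⟨hgs, r, hr⟩ := hg
  let e : A → lp (fun _ : A => ℝ) 2 := fun x => lp.single 2 x (1 : ℝ)
  have he : ∀ x, ‖e x‖ = 1 := fun x => by
    simp [e, lp.norm_single]
  -- `g` is an approximate square root of `M⁻¹ T`, so the Gram matrix of its columns is close to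
  -- `M⁻¹ k`.
  have hinner : ∀ x y, |⟪g (e x), g (e y)⟫_ℝ - M⁻¹ * k x y| ≤ η / M := by
    intro x y
    have h1 : ⟪g (e x), g (e y)⟫_ℝ - M⁻¹ * k x y = ⟪(g * g - M⁻¹ • T) (e y), e x⟫_ℝ := by
      rw [hgs, real_inner_comm]
      change _ = ⟪g (g (e y)) - M⁻¹ • T (e y), e x⟫_ℝ
      rw [inner_sub_left, real_inner_smul_left]
      congr 2
      rw [← hTe]
      have h2 := lp.inner_single_right (𝕜 := ℝ) (G := fun _ : A => ℝ) x 1 (T (e y))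
      rw [h2]
      simp [e]
    rw [h1]
    refine (abs_real_inner_le_norm _ _).trans ?_
    rw [he, mul_one]
    refine (ContinuousLinearMap.le_opNorm _ _).trans ?_
    rw [he, mul_one]
    exact hn
  have hnorm : ∀ x, 1 / (2 * M) ≤ ‖g (e x)‖ ^ 2 := by
    intro x
    have h1 := (abs_le.1 (hinner x x)).1
    rw [real_inner_self_eq_norm_sq, hk1, mul_one] at h1
    have h2 : η / M ≤ 1 / 2 / M := by gcongr
    have h3 : 1 / (2 * M) = M⁻¹ - 1 / 2 / M := by field_simp; norm_num
    linarith
  have hdiff : ∀ x y, dist x y ≤ R → ‖g (e x) - g (e y)‖ ^ 2 ≤ 6 * η / M := by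
    intro x y hxy
    have h1 := (abs_le.1 (hinner x x)).2
    have h2 := (abs_le.1 (hinner y y)).2
    have h3 := (abs_le.1 (hinner x y)).1
    rw [real_inner_self_eq_norm_sq, hk1, mul_one] at h1 h2
    rw [norm_sub_sq_real]
    have h4 := mul_le_mul_of_nonneg_left (abs_le.1 (hkR x y hxy)).2 (inv_nonneg.2 hM.le)
    have h5 : 6 * η / M = 6 * (η / M) := by ring
    have h6 : M⁻¹ * η = η / M := by ring
    linarith
  have hpos : ∀ x, 0 < ‖g (e x)‖ := by
    intro x
    have h1 : 0 < 1 / (2 * M) := by positivity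
    have h2 := hnorm x
    by_contra h3
    have h4 : ‖g (e x)‖ = 0 := le_antisymm (not_lt.1 h3) (norm_nonneg _)
    rw [h4] at h2
    rw [zero_pow two_ne_zero] at h2
    linarith
  have hu0 : ∀ x, lpTwoAbs (g (e x)) ≠ 0 := fun x h => by
    have := norm_lpTwoAbs (g (e x))
    rw [h, norm_zero] at this
    exact (hpos x).ne this
  -- Pointwise absolute values make the columns non-negative; they preserve norms and supports and
  -- do not increase distances.
  refine ⟨max r 1, by positivity, fun x => ‖lpTwoAbs (g (e x))‖⁻¹ • lpTwoAbs (g (e x)),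
    fun x => ⟨?_, fun z => ?_⟩,
    fun x z hz => ?_, fun x y hxy => ?_⟩
  · rw [norm_smul, norm_inv, norm_norm]
    exact inv_mul_cancel₀ (norm_ne_zero_iff.2 (hu0 x))
  · exact mul_nonneg (inv_nonneg.2 (norm_nonneg _)) (abs_nonneg _)
  · refine (hr x z fun h0 => hz ?_).trans (le_max_left _ _)
    change _ * |g (e x) z| = 0
    rw [show g (e x) z = 0 from h0, abs_zero, mul_zero]
  · refine (norm_normalize_sub_le (hu0 x) (hu0 y)).trans ?_
    rw [norm_lpTwoAbs, div_le_iff₀ (hpos x)]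
    refine (mul_le_mul_of_nonneg_left (norm_lpTwoAbs_sub_le _ _) zero_le_two).trans ?_
    refine le_of_sq_le_sq ?_ (by positivity)
    have h1 := hdiff x y hxy
    have h2 := mul_le_mul_of_nonneg_left (hnorm x) (sq_nonneg ε)
    have h3 : 6 * η / M ≤ 6 * (ε ^ 2 / 48) / M := by gcongr
    have h4 : 4 * (6 * (ε ^ 2 / 48) / M) = ε ^ 2 * (1 / (2 * M)) := by field_simp; norm_num
    rw [mul_pow, mul_pow]
    linarith

end KernelOperator

/-! ### Square roots, squares and the cycle of conditions -/

section Equivalences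

variable {X : Type*} [MetricSpace X]

open scoped InnerProductSpace

theorem BoundedGeometry.subtype (hX : BoundedGeometry X) (s : Set X) : BoundedGeometry s := by
  intro r hr
  obtain ⟨N, hN⟩ := hX r hr
  refine ⟨N, fun x => le_trans ?_ (hN x)⟩
  rw [← Subtype.val_injective.encard_image]
  refine encard_le_encard ?_
  rintro _ ⟨y, hy, rfl⟩
  exact hy

/-- Square roots of functions on `X × X` give a kernel of positive type. -/
theorem exists_kernel_of_function {S R ε : ℝ} (hS : 0 < S) (hε : 0 < ε) {Y : Set X}
    {f : X × X → ℝ} (hf0 : ∀ p, 0 ≤ f p) (hfS : Function.support f ⊆ entourage X S)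
    (hf1 : ∀ x ∉ Y, HasSum (fun z => f (z, x)) 1)
    (hfR : ∀ x ∉ Y, ∀ y ∉ Y, dist x y ≤ R → ∑' z, |f (z, x) - f (z, y)| ≤ ε) :
    ∃ S' : ℝ, 0 < S' ∧ ∃ k : (Yᶜ : Set X) → (Yᶜ : Set X) → ℝ, IsPositiveType k ∧
      (∀ x y, k x y = k y x) ∧ (∀ x, k x x = 1) ∧
      (∀ x y, S' ≤ dist x y → k x y = 0) ∧ (∀ x y, dist x y ≤ R → |1 - k x y| ≤ ε) := by
  let v : (Yᶜ : Set X) → lp (fun _ : X => ℝ) 2 := fun x => ⟨fun z => √(f (z, x)),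
    memℓp_two_iff_summable_sq.2 (by
      simpa only [Real.sq_sqrt (hf0 _)] using (hf1 x x.2).summable)⟩
  have hv : ∀ x z, v x z = √(f (z, x)) := fun x z => rfl
  have hv1 : ∀ x, ‖v x‖ ^ 2 = 1 := fun x => by
    have h := lp_two_hasSum_sq (v x)
    simp only [hv, Real.sq_sqrt (hf0 _)] at h
    exact h.unique (hf1 x x.2)
  -- Overlapping supports force distance at most `2S`; the extra one makes the kernel vanish already
  -- at distance equal to the bound. Closeness to one comes from `1 - ⟪v x, v y⟫ = ‖v x - v y‖² / 2`
  -- and `(√s - √t)² ≤ |s - t|`.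
  refine ⟨2 * S + 1, by positivity, fun x y => ⟪v x, v y⟫_ℝ, fun n x c => ?_,
    fun x y => real_inner_comm _ _, fun x => ?_, fun x y hxy => ?_, fun x y hxy => ?_⟩
  · have : ∑ i, ∑ j, c i * c j * ⟪v (x i), v (x j)⟫_ℝ =
        ⟪∑ i, c i • v (x i), ∑ i, c i • v (x i)⟫_ℝ := by
      rw [sum_inner]
      refine Finset.sum_congr rfl fun i _ => ?_
      rw [inner_sum]
      refine Finset.sum_congr rfl fun j _ => ?_
      rw [real_inner_smul_left, real_inner_smul_right, mul_assoc]
    rw [this]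
    exact real_inner_self_nonneg
  · change ⟪v x, v x⟫_ℝ = 1
    rw [real_inner_self_eq_norm_sq, hv1]
  · change ⟪v x, v y⟫_ℝ = 0
    rw [lp.inner_eq_tsum]
    refine (tsum_congr fun z => ?_).trans tsum_zero
    by_contra hz
    have h1 : f (z, (x : X)) ≠ 0 := fun h0 => hz (by rw [hv x, h0, Real.sqrt_zero, inner_zero_left])
    have h2 : f (z, (y : X)) ≠ 0 := fun h0 =>
      hz (by rw [hv y, h0, Real.sqrt_zero, inner_zero_right])
    have h3 : dist z (x : X) ≤ S := hfS h1
    have h4 : dist z (y : X) ≤ S := hfS h2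
    have h5 := dist_triangle_left (x : X) y z
    rw [Subtype.dist_eq] at hxy
    linarith
  · have h1 : ‖v x - v y‖ ^ 2 ≤ ε := by
      refine le_trans ?_ (hfR x x.2 y y.2 hxy)
      refine hasSum_le (fun z => ?_) (lp_two_hasSum_sq (v x - v y))
        ((hf1 x x.2).summable.sub (hf1 y y.2).summable).abs.hasSum
      rw [lp.coeFn_sub, Pi.sub_apply, hv, hv]
      have ha := Real.sqrt_nonneg (f (z, (x : X)))
      have hb := Real.sqrt_nonneg (f (z, (y : X)))
      rw [← sq_abs, sq]
      nth_rewrite 3 [← Real.sq_sqrt (hf0 (z, (x : X)))]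
      nth_rewrite 3 [← Real.sq_sqrt (hf0 (z, (y : X)))]
      rw [sq_sub_sq, abs_mul, mul_comm |_ + _|]
      refine mul_le_mul_of_nonneg_left ?_ (abs_nonneg _)
      rw [abs_of_nonneg (add_nonneg ha hb), abs_le]
      constructor <;> linarith
    have h2 := norm_sub_sq_real (v x) (v y)
    rw [hv1, hv1] at h2
    have h3 := sq_nonneg ‖v x - v y‖
    rw [abs_le]
    constructor <;> linarith

/-- Squares of unit vectors in `ℓ²` give functions on `X × X`. -/
theorem exists_function_of_unit_vectors {S R ε : ℝ} (hε : 0 < ε) {Y : Set X}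
    {ξ : (Yᶜ : Set X) → lp (fun _ : (Yᶜ : Set X) => ℝ) 2}
    (hξ1 : ∀ x, ‖ξ x‖ = 1 ∧ ∀ z, 0 ≤ ξ x z)
    (hξS : ∀ x, Function.support (ξ x) ⊆ Metric.closedBall x S)
    (hξR : ∀ x y, dist x y ≤ R → ‖ξ x - ξ y‖ ≤ ε / 3) :
    ∃ f : X × X → ℝ, (∀ p, f p ∈ Set.Icc (0 : ℝ) 1) ∧
      Function.support f ⊆ entourage X S ∧
      (∀ x ∈ Yᶜ, HasSum (fun z => f (z, x)) 1) ∧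
      (∀ x ∈ Yᶜ, ∀ y ∈ Yᶜ, dist x y ≤ R →
        Summable (fun z => |f (z, x) - f (z, y)|) ∧ ∑' z, |f (z, x) - f (z, y)| ≤ ε) := by
  classical
  let f : X × X → ℝ := fun p =>
    if h : p.1 ∈ Yᶜ ∧ p.2 ∈ Yᶜ then ξ ⟨p.2, h.2⟩ ⟨p.1, h.1⟩ ^ 2 else 0
  have hf : ∀ z x : (Yᶜ : Set X), f (z, x) = ξ x z ^ 2 := fun z x => by
    simp only [f]
    rw [dif_pos ⟨z.2, x.2⟩]
  have hf0 : ∀ p : X × X, ¬ (p.1 ∈ Yᶜ ∧ p.2 ∈ Yᶜ) → f p = 0 := fun p h => dif_neg h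
  have hsq : ∀ x, HasSum (fun z => ξ x z ^ 2) 1 := fun x => by
    have := lp_two_hasSum_sq (ξ x)
    rwa [(hξ1 x).1, one_pow] at this
  have hext : ∀ (g : X → ℝ) (s : ℝ), (∀ z ∉ Yᶜ, g z = 0) →
      HasSum (fun z : (Yᶜ : Set X) => g z) s → HasSum g s := fun g s hg h =>
    (Subtype.val_injective.hasSum_iff (f := g) (by simpa using hg)).1 h
  refine ⟨f, ?_, ?_, ?_, ?_⟩
  · rintro ⟨z, x⟩
    by_cases h : z ∈ Yᶜ ∧ x ∈ Yᶜ
    · have := hf ⟨z, h.1⟩ ⟨x, h.2⟩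
      simp only at this
      rw [this]
      exact ⟨sq_nonneg _, le_hasSum (hsq ⟨x, h.2⟩) ⟨z, h.1⟩ fun _ _ => sq_nonneg _⟩
    · rw [hf0 _ h]; simp
  · rintro ⟨z, x⟩ hp
    by_cases h : z ∈ Yᶜ ∧ x ∈ Yᶜ
    · have := hf ⟨z, h.1⟩ ⟨x, h.2⟩
      simp only at this
      rw [Function.mem_support, this] at hp
      exact hξS ⟨x, h.2⟩ (a := ⟨z, h.1⟩) fun h0 => hp (by rw [h0]; simp)
    · exact absurd (hf0 _ h) hp
  · intro x hx
    refine hext _ _ (fun z hz => hf0 _ fun h => hz h.1) ?_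
    simpa only [← hf] using hsq ⟨x, hx⟩
  · intro x hx y hy hxy
    let x' : (Yᶜ : Set X) := ⟨x, hx⟩
    let y' : (Yᶜ : Set X) := ⟨y, hy⟩
    have hd := lp_two_hasSum_sq (ξ x' - ξ y')
    have hbound := (hd.mul_left (3 / (2 * ε))).add
      (((hsq x').add (hsq y')).mul_left (ε / 3))
    -- A weighted arithmetic–geometric inequality applied to `|a - b| (a + b)`, in place of
    -- Cauchy–Schwarz. After summation the two terms give at most `ε / 6` and `2ε / 3`.
    have hpt : ∀ z, |ξ x' z ^ 2 - ξ y' z ^ 2| ≤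
        3 / (2 * ε) * (ξ x' - ξ y') z ^ 2 + ε / 3 * (ξ x' z ^ 2 + ξ y' z ^ 2) := by
      intro z
      rw [lp.coeFn_sub, Pi.sub_apply]
      set a := ξ x' z
      set b := ξ y' z
      have h1 : ∀ t : ℝ, t ^ 2 = (a - b) ^ 2 → t * (a + b) ≤
          3 / (2 * ε) * (a - b) ^ 2 + ε / 3 * (a ^ 2 + b ^ 2) := by
        intro t ht
        have h2 : 0 ≤ 3 / (2 * ε) * (t - ε / 3 * (a + b)) ^ 2 := by positivity
        have h3 : 3 / (2 * ε) * (t - ε / 3 * (a + b)) ^ 2 =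
            3 / (2 * ε) * t ^ 2 - t * (a + b) + ε / 6 * (a + b) ^ 2 := by
          field_simp
          ring
        rw [h3, ht] at h2
        have h4 : (a + b) ^ 2 ≤ 2 * (a ^ 2 + b ^ 2) := add_sq_le
        nlinarith
      rw [abs_le']
      constructor
      · have := h1 (a - b) rfl
        nlinarith
      · have := h1 (b - a) (by ring)
        nlinarith
    have hs := Summable.of_nonneg_of_le (fun _ => abs_nonneg _) hpt hbound.summable
    have hle := hasSum_le hpt hs.hasSum hbound
    have hfx : HasSum (fun z => |f (z, x) - f (z, y)|)
        (∑' z, |ξ x' z ^ 2 - ξ y' z ^ 2|) := by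
      refine hext _ _ (fun z hz => ?_) ?_
      · rw [hf0 _ fun h => hz h.1, hf0 _ fun h => hz h.1]; simp
      · have h1 : ∀ z : (Yᶜ : Set X), |f (z, x) - f (z, y)| = |ξ x' z ^ 2 - ξ y' z ^ 2| :=
          fun z => by rw [← hf z x', ← hf z y']
        simpa only [h1] using hs.hasSum
    refine ⟨hfx.summable, hfx.tsum_eq.trans_le (hle.trans ?_)⟩
    have h1 : ‖ξ x' - ξ y'‖ ^ 2 ≤ (ε / 3) ^ 2 :=
      pow_le_pow_left₀ (norm_nonneg _) (hξR x' y' hxy) 2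
    have h2 : 3 / (2 * ε) * ‖ξ x' - ξ y'‖ ^ 2 ≤ 3 / (2 * ε) * (ε / 3) ^ 2 := by gcongr
    have h3 : 3 / (2 * ε) * (ε / 3) ^ 2 = ε / 6 := by field_simp; norm_num
    linarith

end Equivalences

theorem mainTheorem9 (X : Type*) [MetricSpace X] (hX : BoundedGeometry X)
    (hsd : StronglyDiscrete X) (U : Set (Ultrafilter X)) (hUo : IsOpen U)
    (hUi : (coarseGroupoid X hX).IsInvariant U) :
    -- functions on `X × X`
    (HasPartialPropertyA X hX (betaBoundary X \ U) ↔
      ∀ ε : ℝ, 0 < ε → ∀ R : ℝ, 0 < R →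
        ∃ S : ℝ, 0 < S ∧ ∃ D : Set X, betaBoundary X \ U ⊆ betaClosure D ∧
          ∃ f : X × X → ℝ, (∀ p, f p ∈ Set.Icc (0 : ℝ) 1) ∧
            Function.support f ⊆ entourage X S ∧
            (∀ x ∈ D, HasSum (fun z => f (z, x)) 1) ∧
            (∀ x ∈ D, ∀ y ∈ D, dist x y ≤ R →
              Summable (fun z => |f (z, x) - f (z, y)|) ∧
              ∑' z, |f (z, x) - f (z, y)| ≤ ε)) ∧
    -- maps to positive unit vectors in `ℓ¹(X)`
    (HasPartialPropertyA X hX (betaBoundary X \ U) ↔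
      ∀ ε : ℝ, 0 < ε → ∀ R : ℝ, 0 < R →
        ∃ S : ℝ, 0 < S ∧ ∃ D : Set X, betaBoundary X \ U ⊆ betaClosure D ∧
          ∃ ξ : D → lp (fun _ : X => ℝ) 1,
            (∀ x, ‖ξ x‖ = 1 ∧ ∀ z, 0 ≤ ξ x z) ∧
            (∀ x, Function.support (ξ x) ⊆ Metric.closedBall (x : X) S) ∧
            (∀ x y, dist x y ≤ R → ‖ξ x - ξ y‖ ≤ ε)) ∧
    -- maps to positive unit vectors in `ℓ²(Yᶜ)` for some `Y` in the ideal of `U`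
    (HasPartialPropertyA X hX (betaBoundary X \ U) ↔
      ∀ ε : ℝ, 0 < ε → ∀ R : ℝ, 0 < R →
        ∃ S : ℝ, 0 < S ∧ ∃ Y ∈ idealOf U,
          ∃ ξ : (Yᶜ : Set X) → lp (fun _ : (Yᶜ : Set X) => ℝ) 2,
            (∀ x, ‖ξ x‖ = 1 ∧ ∀ z, 0 ≤ ξ x z) ∧
            (∀ x, Function.support (ξ x) ⊆ Metric.closedBall x S) ∧
            (∀ x y, dist x y ≤ R → ‖ξ x - ξ y‖ ≤ ε)) ∧
    -- kernels of positive type on `Yᶜ` for some `Y` in the ideal of `U`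
    (HasPartialPropertyA X hX (betaBoundary X \ U) ↔
      ∀ ε : ℝ, 0 < ε → ∀ R : ℝ, 0 < R →
        ∃ S : ℝ, 0 < S ∧ ∃ Y ∈ idealOf U,
          ∃ k : (Yᶜ : Set X) → (Yᶜ : Set X) → ℝ, IsPositiveType k ∧
            (∀ x y, k x y = k y x) ∧ (∀ x, k x x = 1) ∧
            (∀ x y, S ≤ dist x y → k x y = 0) ∧
            (∀ x y, dist x y ≤ R → |1 - k x y| ≤ ε)) := by
  classical
  rw [hasPartialPropertyA_iff_functionCondition hX hUo hUi]
  have vectors_to_function := fun (h : ∀ ε : ℝ, 0 < ε → ∀ R : ℝ, 0 < R →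
      ∃ S : ℝ, 0 < S ∧ ∃ Y ∈ idealOf U,
        ∃ ξ : (Yᶜ : Set X) → lp (fun _ : (Yᶜ : Set X) => ℝ) 2,
          (∀ x, ‖ξ x‖ = 1 ∧ ∀ z, 0 ≤ ξ x z) ∧
          (∀ x, Function.support (ξ x) ⊆ Metric.closedBall x S) ∧
          (∀ x y, dist x y ≤ R → ‖ξ x - ξ y‖ ≤ ε)) =>
    show FunctionCondition (betaBoundary X \ U) from fun ε hε R hR => by
      obtain ⟨S, hS, Y, hY, ξ, h1, h2, h3⟩ := h (ε / 3) (by positivity) R hR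
      exact ⟨S, hS, Yᶜ, betaBoundary_diff_subset_betaClosure_compl hY,
        exists_function_of_unit_vectors hε h1 h2 h3⟩
  have function_to_kernel := fun (h : FunctionCondition (betaBoundary X \ U)) (ε : ℝ) (hε : 0 < ε)
      (R : ℝ) (hR : 0 < R) =>
    show ∃ S : ℝ, 0 < S ∧ ∃ Y ∈ idealOf U,
        ∃ k : (Yᶜ : Set X) → (Yᶜ : Set X) → ℝ, IsPositiveType k ∧
          (∀ x y, k x y = k y x) ∧ (∀ x, k x x = 1) ∧
          (∀ x y, S ≤ dist x y → k x y = 0) ∧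
          (∀ x y, dist x y ≤ R → |1 - k x y| ≤ ε) by
      obtain ⟨S, hS, Y, hY, f, h1, h2, h3, h4⟩ := h.exists_mem_idealOf hX hUo hUi hε hR
      obtain ⟨S', hS', k, hk⟩ := exists_kernel_of_function hS hε (fun p => (h1 p).1) h2 h3 h4
      exact ⟨S', hS', Y, hY, k, hk⟩
  have kernel_to_vectors := fun (h : ∀ ε : ℝ, 0 < ε → ∀ R : ℝ, 0 < R →
      ∃ S : ℝ, 0 < S ∧ ∃ Y ∈ idealOf U,
        ∃ k : (Yᶜ : Set X) → (Yᶜ : Set X) → ℝ, IsPositiveType k ∧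
          (∀ x y, k x y = k y x) ∧ (∀ x, k x x = 1) ∧
          (∀ x y, S ≤ dist x y → k x y = 0) ∧
          (∀ x y, dist x y ≤ R → |1 - k x y| ≤ ε)) (ε : ℝ) (hε : 0 < ε) (R : ℝ) (hR : 0 < R) =>
    show ∃ S : ℝ, 0 < S ∧ ∃ Y ∈ idealOf U,
        ∃ ξ : (Yᶜ : Set X) → lp (fun _ : (Yᶜ : Set X) => ℝ) 2,
          (∀ x, ‖ξ x‖ = 1 ∧ ∀ z, 0 ≤ ξ x z) ∧
          (∀ x, Function.support (ξ x) ⊆ Metric.closedBall x S) ∧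
          (∀ x y, dist x y ≤ R → ‖ξ x - ξ y‖ ≤ ε) by
      obtain ⟨S, hS, Y, hY, k, h1, h2, h3, h4, h5⟩ :=
        h (min (1 / 2) (ε ^ 2 / 48)) (lt_min (by norm_num) (by positivity)) R hR
      obtain ⟨S', hS', ξ, hξ⟩ := exists_unit_vectors_of_kernel (hX.subtype _) hS hε h1 h2 h3 h4 h5
      exact ⟨S', hS', Y, hY, ξ, hξ⟩
  exact ⟨Iff.rfl, functionCondition_iff_lp_one _,
    ⟨fun h => kernel_to_vectors (function_to_kernel h), vectors_to_function⟩,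
    ⟨function_to_kernel, fun h => vectors_to_function (kernel_to_vectors h)⟩⟩
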